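/- Let $X$ be a CAT(0) space. A reflection of $X$ is an isometry $r$ with $r^2=1$ whose fixed-point set $F_r$ (its wall) has empty interior and is such that $X\setminus F_r$ has exactly two connected components, both convex and interchanged by $r$. Let $W$ be a cocompact discrete reflection group of $X$; that is, $W$ is a group of isometries of $X$ generated by reflections, the action is proper (for all $x\in X$ and $N>0$ the set $\{w\in W : wx\in B(x,N)\}$ is finite), and, for a chamber $C$, i.e. a connected component of $X\setminus\bigcup_{r\in R}F_r$, where $R$ is the set of all reflections of $X$ lying in $W$, the closure $\overline{C}$ is compact and $\{w\in W : wC=C\}=\{1\}$. (This does not depend on the choice of the chamber.) Fix a chamber $C$. For $r\in R$ let $X_r^+$ be the component of $X\setminus F_r$ containing $C$, and let $S\subset R$ be minimal with $C=\bigcap_{s\in S}X_s^+$, i.e. $C\neq\bigcap_{s\in S\setminus\{s'\}}X_s^+$ for each $s'\in S$. Then $S$ generates $W$ (and $(W,S)$ is a Coxeter system). Let $\ell$ be the word length on $W$ with respect to $S$, let $d(u,v)=\ell(u^{-1}v)$ be the word metric, and for $s_0\in S$ put $$W^{\{s_0\}}=\{w\in W : \ell(ws)>\ell(w)\text{ for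 each } s\in S\setminus\{s_0\}\}\setminus\{1\}.$$ Suppose that $s_0,t_0\in S$ are such that the element $s_0t_0$ has infinite order and $W^{\{s_0\}}$ is quasi-dense in $W$ for the word metric, i.e. there is $N>0$ such that every element of $W$ is at distance at most $N$ from some element of $W^{\{s_0\}}$. Then there exists a point $\alpha$ of the boundary at infinity $\partial X$ (the set of asymptoty classes of geodesic rays, with the cone topology) whose orbit $W\alpha$ is dense in $\partial X$. -/

import Mathlib

open scoped NNReal

namespace CATReflection

section Geodesics

variable {X : Type*} [MetricSpace X]

/-- `ξ`, restricted to `[0, d(x, y)]`, is a geodesic from `x` to `y`. -/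
structure IsGeodesic (ξ : ℝ → X) (x y : X) : Prop where
  source : ξ 0 = x
  target : ξ (dist x y) = y
  isometric : ∀ s ∈ Set.Icc 0 (dist x y), ∀ t ∈ Set.Icc 0 (dist x y),
    dist (ξ s) (ξ t) = |s - t|

/-- `z` lies on the image of some geodesic from `x` to `y`. -/
def OnGeodesic (x y z : X) : Prop :=
  ∃ ξ : ℝ → X, IsGeodesic ξ x y ∧ ∃ t ∈ Set.Icc 0 (dist x y), ξ t = z

/-- Every geodesic joining two points of `A` stays in `A`
(in a geodesic space this is the usual notion of a convex subset). -/
def IsGeodConvex (A : Set X) : Prop :=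
  ∀ x ∈ A, ∀ y ∈ A, ∀ z, OnGeodesic x y z → z ∈ A

variable (X) in
/-- Any two points are joined by a geodesic. -/
def IsGeodesicSpace : Prop := ∀ x y : X, ∃ ξ : ℝ → X, IsGeodesic ξ x y

variable (X) in
/-- A CAT(0) space: a geodesic space whose geodesic triangles are no thicker than their
comparison triangles `p' q' r'` in the Euclidean plane. Here `x` and `y` lie on the sides
`[p, q]` and `[p, r]`, and `x'`, `y'` are their comparison points. -/
structure IsCAT0 : Prop where
  geodesic : IsGeodesicSpace X
  comparison : ∀ (p q r x y : X) (p' q' r' x' y' : EuclideanSpace ℝ (Fin 2)),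
    dist p' q' = dist p q → dist p' r' = dist p r → dist q' r' = dist q r →
    OnGeodesic p q x → x' ∈ segment ℝ p' q' → dist p' x' = dist p x →
    OnGeodesic p r y → y' ∈ segment ℝ p' r' → dist p' y' = dist p y →
    dist x y ≤ dist x' y'

end Geodesics

section Boundary

variable (X : Type*) [MetricSpace X]

/-- Geodesic rays `c : [0, ∞) → X`. As a subtype of `C(ℝ≥0, X)` they carry the topology of
uniform convergence on compact sets. -/
abbrev GeodesicRay := {c : C(ℝ≥0, X) // Isometry c}

/-- Two rays are asymptotic if they stay at bounded distance. -/
def asymptotic : Setoid (GeodesicRay X) where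
  r c c' := ∃ K : ℝ, ∀ t, dist (c.1 t) (c'.1 t) ≤ K
  iseqv :=
    { refl := fun _ => ⟨0, fun _ => (dist_self _).le⟩
      symm := fun ⟨K, h⟩ => ⟨K, fun t => (dist_comm _ _).trans_le (h t)⟩
      trans := fun ⟨K, h⟩ ⟨L, h'⟩ =>
        ⟨K + L, fun t => (dist_triangle _ _ _).trans (add_le_add (h t) (h' t))⟩ }

/-- The boundary at infinity `∂X`: asymptoty classes of geodesic rays. -/
def Boundary := Quotient (asymptotic X)

variable {X}

/-- The endpoint `c(∞) ∈ ∂X` of a ray. -/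
def endpoint (c : GeodesicRay X) : Boundary X := Quotient.mk (asymptotic X) c

/-- The cone topology on `∂X` seen from `x₀`: `∂X` is identified with the rays issuing from `x₀`
(in a complete CAT(0) space every boundary point is represented by exactly one such ray), with
uniform convergence on compact sets. -/
@[reducible]
def coneTopology (x₀ : X) : TopologicalSpace (Boundary X) :=
  TopologicalSpace.coinduced
    (fun c : {c : GeodesicRay X // c.1 0 = x₀} => endpoint c.1) inferInstance

/-- The translate of a ray by an isometry. -/
def mapRay (g : X ≃ᵢ X) (c : GeodesicRay X) : GeodesicRay X :=
  ⟨⟨fun t => g (c.1 t), g.continuous.comp c.1.continuous⟩, g.isometry.comp c.2⟩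

/-- Isometries act on the boundary by `g • c(∞) = (g ∘ c)(∞)`. -/
instance : MulAction (X ≃ᵢ X) (Boundary X) where
  smul g := Quotient.map (sa := asymptotic X) (sb := asymptotic X) (mapRay g)
    fun _ _ ⟨K, h⟩ => ⟨K, fun t => (g.isometry.dist_eq _ _).trans_le (h t)⟩
  one_smul := by rintro ⟨c⟩; rfl
  mul_smul := by rintro g h ⟨c⟩; rfl

end Boundary

section Reflections

variable {X : Type*} [MetricSpace X]

/-- The fixed-point set `F_r`. -/
def wall (r : X ≃ᵢ X) : Set X := {x | r x = x}

/-- A reflection: an involution whose fixed-point set has empty interior and whose complement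
has exactly two connected components, both convex and interchanged by `r`. -/
structure IsReflection (r : X ≃ᵢ X) : Prop where
  sq_eq_one : r ^ 2 = 1
  interior_wall : interior (wall r) = ∅
  two_sides : ∃ A B : Set X, A ≠ B ∧
    {D : Set X | ∃ x ∈ (wall r)ᶜ, D = connectedComponentIn (wall r)ᶜ x} = {A, B} ∧
    IsGeodConvex A ∧ IsGeodConvex B ∧ r '' A = B ∧ r '' B = A

/-- The set `R` of all reflections belonging to `W`. -/
def reflections (W : Subgroup (X ≃ᵢ X)) : Set (X ≃ᵢ X) := {r | r ∈ W ∧ IsReflection r}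

/-- The complement of the union of all walls. -/
def wallComplement (W : Subgroup (X ≃ᵢ X)) : Set X := (⋃ r ∈ reflections W, wall r)ᶜ

/-- The chamber containing `x₀` (for `x₀` on no wall): its connected component in the complement
of the walls. -/
def chamber (W : Subgroup (X ≃ᵢ X)) (x₀ : X) : Set X :=
  connectedComponentIn (wallComplement W) x₀

/-- The side `X_r⁺` of the wall of `r` that contains `x₀`. -/
def posSide (x₀ : X) (r : X ≃ᵢ X) : Set X := connectedComponentIn (wall r)ᶜ x₀

/-- `W` is a cocompact discrete reflection group of `X`: generated by reflections, acting properly,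
and some chamber has compact closure and trivial stabilizer (`W` permutes the chambers
transitively, so the choice of the chamber is immaterial). -/
structure IsCocompactDiscreteReflectionGroup (W : Subgroup (X ≃ᵢ X)) : Prop where
  generated : ∃ A : Set (X ≃ᵢ X), (∀ r ∈ A, IsReflection r) ∧ Subgroup.closure A = W
  proper : ∀ (x : X) (N : ℝ), 0 < N → {g : X ≃ᵢ X | g ∈ W ∧ g x ∈ Metric.ball x N}.Finite
  cocompact_discrete : ∃ y ∈ wallComplement W, IsCompact (closure (chamber W y)) ∧
    ∀ g ∈ W, g '' chamber W y = chamber W y → g = 1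

/-- `S` is a minimal set of reflections in `W` such that the chamber `C` of `x₀` is
`⋂_{s ∈ S} X_s⁺`. -/
structure IsMinimalReflectionSet (W : Subgroup (X ≃ᵢ X)) (x₀ : X) (S : Set (X ≃ᵢ X)) : Prop where
  subset_reflections : S ⊆ reflections W
  chamber_eq : chamber W x₀ = ⋂ s ∈ S, posSide x₀ s
  minimal : ∀ s₀ ∈ S, chamber W x₀ ≠ ⋂ s ∈ S \ {s₀}, posSide x₀ s

end Reflections

section Words

variable {G : Type*} [Group G]

/-- The word length `ℓ(w)` with respect to `S`. It is used for `S` a set of involutions, so that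
inverses of generators are not needed in words. -/
noncomputable def wordLength (S : Set G) (w : G) : ℕ :=
  sInf {n | ∃ l : List G, (∀ s ∈ l, s ∈ S) ∧ l.prod = w ∧ l.length = n}

/-- The word metric `d(u, v) = ℓ(u⁻¹ v)`. -/
noncomputable def wordDist (S : Set G) (u v : G) : ℕ := wordLength S (u⁻¹ * v)

/-- `W^{s₀}`: the nontrivial `w ∈ W` with `ℓ(ws) > ℓ(w)` for each `s ∈ S \ {s₀}`. -/
def lastLetterSet (W : Subgroup G) (S : Set G) (s₀ : G) : Set G :=
  {w | w ∈ W ∧ ∀ s ∈ S \ {s₀}, wordLength S w < wordLength S (w * s)} \ {1}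

/-- `A` is quasi-dense in `W` with respect to the word metric of `S`. -/
def IsQuasiDense (W : Subgroup G) (S : Set G) (A : Set G) : Prop :=
  ∃ N : ℕ, 0 < N ∧ ∀ w ∈ W, ∃ a ∈ A, wordDist S w a ≤ N

end Words

end CATReflection

/-! Let C be the chamber of `b`, and call a point in front of a wall if it lies on the side of C.
For w in W^{s₀}, the exchange condition (`exchange`) turns the length inequalities into geometry:
w⁻¹C is in front of every wall of S except possibly that of s₀ (`inv_apply_mem_posSide`). Since s₀t₀
has infinite order, t₀w⁻¹C is in front of every wall of S except possibly that of t₀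
(`apply_inv_apply_mem_of_mem_lastLetterSet`). Moreover the walls of s₀ and t₀ are disjoint and their
front sides cover X (`mem_posSide_or`). Hence a geodesic from a point of the first kind to one of
the second kind passes through C (`exists_between_mem_chamber`).

W is infinite and W^{s₀} is quasi-dense, so there are w_n in W^{s₀} with w_n b tending to infinity.
Let α be an ultralimit in ∂X of the points t₀w_n⁻¹b. For every v in W^{s₀} the geodesics from v⁻¹b
to these points cross C, so the ray from v⁻¹b to α passes uniformly near b. Translating by v, the
ray from b to vα passes uniformly near vb. The points vb are coarsely dense in X, so every point of
every ray from x₀ is at bounded distance from a ray from x₀ to a point of Wα. By convexity of the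
metric this gives density in the cone topology (`dense_coneTopology`). -/

namespace CATReflection

/-! ### Geodesics and comparison in CAT(0) spaces. -/

section Geodesics

variable {X : Type*} [MetricSpace X] {x y z : X} {ξ : ℝ → X} {t : ℝ}

theorem IsGeodesic.dist_left (h : IsGeodesic ξ x y) (ht : t ∈ Set.Icc 0 (dist x y)) :
    dist x (ξ t) = t := by
  have := h.isometric 0 ⟨le_rfl, dist_nonneg⟩ t ht
  rw [h.source, zero_sub, abs_neg, abs_of_nonneg ht.1] at this
  exact this

theorem IsGeodesic.dist_right (h : IsGeodesic ξ x y) (ht : t ∈ Set.Icc 0 (dist x y)) :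
    dist (ξ t) y = dist x y - t := by
  have := h.isometric t ht (dist x y) ⟨dist_nonneg, le_rfl⟩
  rw [h.target, abs_sub_comm, abs_of_nonneg (sub_nonneg.2 ht.2)] at this
  exact this

theorem IsGeodesic.continuousOn (h : IsGeodesic ξ x y) :
    ContinuousOn ξ (Set.Icc 0 (dist x y)) := by
  refine (LipschitzOnWith.of_dist_le_mul (K := 1) fun s hs t ht => ?_).continuousOn
  rw [h.isometric s hs t ht, NNReal.coe_one, one_mul, Real.dist_eq]

/-- A point is on a geodesic from `x` to `y` iff the triangle inequality is an equality. -/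
theorem onGeodesic_iff (hX : IsGeodesicSpace X) :
    OnGeodesic x y z ↔ dist x z + dist z y = dist x y := by
  constructor
  · rintro ⟨ξ, h, t, ht, rfl⟩
    rw [h.dist_left ht, h.dist_right ht]; ring
  · intro h
    obtain ⟨ξ, hξ⟩ := hX x z
    obtain ⟨η, hη⟩ := hX z y
    have hxz : 0 ≤ dist x z := dist_nonneg
    have hzy : 0 ≤ dist z y := dist_nonneg
    -- Concatenation of geodesics from x to z and from z to y; equality in the triangle inequality
    -- makes it a geodesic.
    let ζ : ℝ → X := fun s => if s ≤ dist x z then ξ s else η (s - dist x z)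
    have hζ1 : ∀ s, s ≤ dist x z → ζ s = ξ s := fun s hs => if_pos hs
    have hζ2 : ∀ s, ¬ s ≤ dist x z → ζ s = η (s - dist x z) := fun s hs => if_neg hs
    have key : ∀ s ∈ Set.Icc 0 (dist x y), ∀ t ∈ Set.Icc 0 (dist x y), s ≤ t →
        dist (ζ s) (ζ t) = t - s := by
      rintro s ⟨hs0, hs1⟩ t ⟨ht0, ht1⟩ hst
      by_cases ht : t ≤ dist x z
      · rw [hζ1 s (hst.trans ht), hζ1 t ht, hξ.isometric s ⟨hs0, hst.trans ht⟩ t ⟨ht0, ht⟩,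
          abs_sub_comm, abs_of_nonneg (sub_nonneg.2 hst)]
      · push Not at ht
        have ht' : t - dist x z ∈ Set.Icc 0 (dist z y) := ⟨by linarith, by linarith⟩
        by_cases hs : s ≤ dist x z
        · rw [hζ1 s hs, hζ2 t ht.not_ge]
          have h1 := hξ.dist_left ⟨hs0, hs⟩
          have h2 := hξ.dist_right ⟨hs0, hs⟩
          have h3 := hη.dist_left ht'
          have h4 := hη.dist_right ht'
          apply le_antisymm
          · linarith [dist_triangle (ξ s) z (η (t - dist x z))]
          · linarith [dist_triangle4 x (ξ s) (η (t - dist x z)) y]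
        · rw [hζ2 s hs, hζ2 t ht.not_ge]
          push Not at hs
          rw [hη.isometric _ ⟨by linarith, by linarith⟩ _ ht', abs_sub_comm, abs_of_nonneg]
          · ring
          · linarith
    refine ⟨ζ, ⟨?_, ?_, ?_⟩, dist x z, ⟨hxz, by linarith⟩, ?_⟩
    · rw [hζ1 _ hxz, hξ.source]
    · by_cases hy : dist x y ≤ dist x z
      · have h0 : dist z y = 0 := by linarith
        have : dist x y = dist x z := by linarith
        rw [hζ1 _ hy, this, hξ.target]
        exact dist_eq_zero.1 h0
      · rw [hζ2 _ hy, ← h, add_sub_cancel_left, hη.target]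
    · intro s hs t ht
      rcases le_total s t with hst | hst
      · rw [key s hs t ht hst, abs_sub_comm, abs_of_nonneg (sub_nonneg.2 hst)]
      · rw [dist_comm, key t ht s hs hst, abs_of_nonneg (sub_nonneg.2 hst)]
    · rw [hζ1 _ le_rfl, hξ.target]

/-- Every admissible triple of side lengths is realized by a triangle in the plane. -/
theorem exists_euclidean_triangle {a b c : ℝ} (ha : 0 ≤ a) (hb : 0 ≤ b) (hc : 0 ≤ c)
    (h1 : a ≤ b + c) (h2 : b ≤ a + c) (h3 : c ≤ a + b) :
    ∃ q r : EuclideanSpace ℝ (Fin 2), ‖q‖ = a ∧ ‖r‖ = b ∧ ‖q - r‖ = c := by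
  rcases ha.eq_or_lt with rfl | ha
  · refine ⟨0, !₂[b, 0], by simp, ?_, ?_⟩
    · simp [EuclideanSpace.norm_eq, Real.sqrt_sq hb]
    · have : b = c := by linarith
      simp [EuclideanSpace.norm_eq, this, Real.sqrt_sq hc]
  · set u := (a ^ 2 + b ^ 2 - c ^ 2) / (2 * a) with hu
    -- u is the first coordinate of the third vertex, given by the law of cosines when q lies on the
    -- first axis.
    have hua : 2 * a * u = a ^ 2 + b ^ 2 - c ^ 2 := by rw [hu]; field_simp
    have hub : 0 ≤ b ^ 2 - u ^ 2 := by
      have hA : 2 * a * (b - u) ≥ 0 := by nlinarith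
      have hB : 2 * a * (b + u) ≥ 0 := by nlinarith
      have hA' : 0 ≤ b - u := by
        by_contra hneg; push Not at hneg; nlinarith
      have hB' : 0 ≤ b + u := by
        by_contra hneg; push Not at hneg; nlinarith
      nlinarith
    refine ⟨!₂[a, 0], !₂[u, √(b ^ 2 - u ^ 2)], ?_, ?_, ?_⟩
    · simp [EuclideanSpace.norm_eq, Real.sqrt_sq ha.le]
    · rw [EuclideanSpace.norm_eq, Real.sqrt_eq_iff_mul_self_eq (by positivity) hb]
      simp [Real.sq_sqrt hub]
      ring
    · rw [EuclideanSpace.norm_eq, Real.sqrt_eq_iff_mul_self_eq (by positivity) hc]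
      simp [Real.sq_sqrt hub]
      linarith

/-- Points dividing two sides of a triangle in the same ratio are at most as far apart as in
the Euclidean plane. -/
theorem IsCAT0.dist_le_mul (hX : IsCAT0 X) {p q r x y : X} {a : ℝ} (ha0 : 0 ≤ a) (ha1 : a ≤ 1)
    (hpx : dist p x = a * dist p q) (hxq : dist x q = (1 - a) * dist p q)
    (hpy : dist p y = a * dist p r) (hyr : dist y r = (1 - a) * dist p r) :
    dist x y ≤ a * dist q r := by
  obtain ⟨q', r', hq, hr, hqr⟩ := exists_euclidean_triangle (a := dist p q) (b := dist p r)
    (c := dist q r) dist_nonneg dist_nonneg dist_nonneg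
    (by linarith [dist_triangle p r q, dist_comm q r])
    (dist_triangle p q r) (by linarith [dist_triangle q p r, dist_comm p q])
  have hseg : ∀ v : EuclideanSpace ℝ (Fin 2), a • v ∈ segment ℝ 0 v := fun v =>
    ⟨1 - a, a, by linarith, ha0, by ring, by simp⟩
  have hn : ∀ v : EuclideanSpace ℝ (Fin 2), dist 0 (a • v) = a * ‖v‖ := fun v => by
    rw [dist_zero_left, norm_smul, Real.norm_of_nonneg ha0]
  refine (hX.comparison p q r x y 0 q' r' (a • q') (a • r') (by simpa using hq) (by simpa using hr)
    (by simpa [dist_eq_norm] using hqr)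
    ((onGeodesic_iff hX.geodesic).2 (by rw [hpx, hxq]; ring)) (hseg q') (by rw [hn, hq, hpx])
    ((onGeodesic_iff hX.geodesic).2 (by rw [hpy, hyr]; ring)) (hseg r')
    (by rw [hn, hr, hpy])).trans_eq ?_
  rw [dist_eq_norm, ← smul_sub, norm_smul, hqr, Real.norm_of_nonneg ha0]

/-- A point between `p` and `q` is determined by its distance from `p`. -/
theorem IsCAT0.eq_of_dist_eq (hX : IsCAT0 X) {p q x y : X} (hx : dist p x + dist x q = dist p q)
    (hy : dist p y + dist y q = dist p q) (h : dist p x = dist p y) : x = y := by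
  rcases (dist_nonneg (x := p) (y := q)).eq_or_lt with h0 | h0
  · have h1 : dist p x = 0 := by
      linarith [dist_nonneg (x := p) (y := x), dist_nonneg (x := x) (y := q)]
    rw [← dist_eq_zero.1 h1, ← dist_eq_zero.1 (h.symm.trans h1)]
  · have hle := hX.dist_le_mul (p := p) (q := q) (r := q) (x := x) (y := y) (a := dist p x / dist p q)
      (by positivity) (by rw [div_le_one h0]; linarith [dist_nonneg (x := x) (y := q)])
      (by field_simp) (by field_simp; linarith) (by rw [h]; field_simp)
      (by rw [h]; field_simp; linarith)
    rw [dist_self, mul_zero] at hle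
    exact dist_le_zero.1 hle

/-- Two geodesics with the same target stay as close as their sources. -/
theorem IsCAT0.dist_le_of_common_target (hX : IsCAT0 X) {p q z x y : X}
    (hx : dist p x + dist x z = dist p z) (hy : dist q y + dist y z = dist q z)
    (hxy : dist p x = dist q y) : dist x y ≤ dist p q := by
  rcases (dist_nonneg (x := p) (y := z)).eq_or_lt with h0 | h0
  · have h1 : dist p x = 0 := by
      linarith [dist_nonneg (x := p) (y := x), dist_nonneg (x := x) (y := z)]
    rw [← dist_eq_zero.1 h1, ← dist_eq_zero.1 (hxy.symm.trans h1)]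
  · set a := dist p x / dist p z with ha
    have ha0 : 0 ≤ a := by positivity
    have ha1 : a ≤ 1 := by rw [ha, div_le_one h0]; linarith [dist_nonneg (x := x) (y := z)]
    have hax : dist p x = a * dist p z := by rw [ha]; field_simp
    obtain ⟨η, hη⟩ := hX.geodesic q z
    have hL : 0 ≤ dist q z := dist_nonneg
    have hm : a * dist q z ∈ Set.Icc 0 (dist q z) :=
      ⟨by positivity, mul_le_of_le_one_left hL ha1⟩
    have hmy : dist q y ∈ Set.Icc 0 (dist q z) :=
      ⟨dist_nonneg, by linarith [dist_nonneg (x := y) (y := z)]⟩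
    have hyη : y = η (dist q y) := by
      refine hX.eq_of_dist_eq hy ?_ (hη.dist_left hmy).symm
      rw [hη.dist_left hmy, hη.dist_right hmy]; ring
    -- The auxiliary point divides [q, z] in the ratio in which x divides [p, z]. Comparison at z
    -- bounds its distance to x by (1 - a) d(p, q); its distance to y is a |d(p, z) - d(q, z)|, at
    -- most a d(p, q).
    have h1 : dist x (η (a * dist q z)) ≤ (1 - a) * dist p q := by
      refine hX.dist_le_mul (p := z) (by linarith) (by linarith) ?_ ?_ ?_ ?_
      · rw [dist_comm z, dist_comm z]; linarith
      · rw [dist_comm, dist_comm z]; linarith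
      · rw [dist_comm z, dist_comm z, hη.dist_right hm]; ring
      · rw [dist_comm, dist_comm z, hη.dist_left hm]; ring
    have h2 : dist (η (a * dist q z)) y ≤ a * dist p q := by
      conv_lhs => rw [hyη]
      rw [hη.isometric _ hm _ hmy, ← hxy, hax, ← mul_sub, abs_mul, abs_of_nonneg ha0]
      refine mul_le_mul_of_nonneg_left ?_ ha0
      rw [abs_le]
      constructor <;> linarith [dist_triangle p q z, dist_triangle q p z, dist_comm p q]
    linarith [dist_triangle x (η (a * dist q z)) y]

/-- A geodesic joining two sets of an open cover meets both at once. -/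
theorem IsGeodesicSpace.exists_between_mem_inter (hX : IsGeodesicSpace X) {U V : Set X}
    (hU : IsOpen U) (hV : IsOpen V) (hUV : U ∪ V = Set.univ) (hx : x ∈ U) (hy : y ∈ V) :
    ∃ z, dist x z + dist z y = dist x y ∧ z ∈ U ∧ z ∈ V := by
  obtain ⟨ξ, hξ⟩ := hX x y
  have hpre := isPreconnected_Icc.image ξ hξ.continuousOn
  obtain ⟨_, ⟨t, ht, rfl⟩, hzU, hzV⟩ := hpre U V hU hV (by rw [hUV]; exact Set.subset_univ _)
    ⟨x, ⟨0, ⟨le_rfl, dist_nonneg⟩, hξ.source⟩, hx⟩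
    ⟨y, ⟨_, ⟨dist_nonneg, le_rfl⟩, hξ.target⟩, hy⟩
  exact ⟨_, by rw [hξ.dist_left ht, hξ.dist_right ht]; ring, hzU, hzV⟩

/-- If no geodesic from `x` to `y` leaves `F` then `y` is in the component of `x` in `F`. -/
theorem IsGeodesicSpace.mem_connectedComponentIn (hX : IsGeodesicSpace X) {F : Set X}
    (h : ∀ z, dist x z + dist z y = dist x y → z ∈ F) : y ∈ connectedComponentIn F x := by
  obtain ⟨ξ, hξ⟩ := hX x y
  have hpre := isPreconnected_Icc.image ξ hξ.continuousOn
  refine hpre.subset_connectedComponentIn (x := x) ⟨0, ⟨le_rfl, dist_nonneg⟩, hξ.source⟩ ?_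
    ⟨_, ⟨dist_nonneg, le_rfl⟩, hξ.target⟩
  rintro _ ⟨t, ht, rfl⟩
  exact h _ (by rw [hξ.dist_left ht, hξ.dist_right ht]; ring)

/-- Balls are connected because geodesics from the centre stay inside. This makes the sides of a
wall open. -/
theorem IsGeodesicSpace.locallyConnectedSpace (hX : IsGeodesicSpace X) :
    LocallyConnectedSpace X := by
  refine locallyConnectedSpace_of_connected_bases (fun (x : X) (ε : ℝ) => Metric.ball x ε)
    (fun _ ε => 0 < ε) (fun x => Metric.nhds_basis_ball) fun x ε hε => ?_
  have : Metric.ball x ε = connectedComponentIn (Metric.ball x ε) x := by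
    refine Set.Subset.antisymm (fun y hy => hX.mem_connectedComponentIn fun z hz => ?_)
      (connectedComponentIn_subset _ _)
    rw [Metric.mem_ball, dist_comm] at hy ⊢
    linarith [dist_nonneg (x := z) (y := y)]
  rw [this]
  exact isPreconnected_connectedComponentIn

end Geodesics

/-! ### A single reflection, its wall and its two sides. -/

section Reflections

variable {X : Type*} [MetricSpace X] {r g : X ≃ᵢ X} {b x y : X}

theorem isClosed_wall (r : X ≃ᵢ X) : IsClosed (wall r) :=
  isClosed_eq r.continuous continuous_id

theorem mem_posSide_self (hb : b ∉ wall r) : b ∈ posSide b r := mem_connectedComponentIn hb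

theorem notMem_wall_of_mem_posSide (h : x ∈ posSide b r) : x ∉ wall r :=
  connectedComponentIn_subset _ _ h

theorem posSide_eq_of_mem (h : x ∈ posSide b r) : posSide b r = posSide x r :=
  connectedComponentIn_eq h

theorem wall_conj (g r : X ≃ᵢ X) : g '' wall r = wall (g * r * g⁻¹) := by
  ext x
  constructor
  · rintro ⟨y, hy, rfl⟩
    change g (r (g⁻¹ (g y))) = g y
    rw [IsometryEquiv.inv_apply_self, show r y = y from hy]
  · intro hx
    refine ⟨g⁻¹ x, ?_, IsometryEquiv.apply_inv_self g x⟩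
    apply g.injective
    rw [IsometryEquiv.apply_inv_self]
    exact hx

theorem apply_mem_wall_conj : g x ∈ wall (g * r * g⁻¹) ↔ x ∈ wall r := by
  rw [← wall_conj, g.injective.mem_set_image]

theorem image_posSide (g : X ≃ᵢ X) (hb : b ∉ wall r) :
    g '' posSide b r = posSide (g b) (g * r * g⁻¹) := by
  have h := g.toHomeomorph.image_connectedComponentIn (s := (wall r)ᶜ) hb
  rw [Set.image_compl_eq g.toHomeomorph.bijective] at h
  have hw : g.toHomeomorph '' wall r = wall (g * r * g⁻¹) := wall_conj g r
  rw [hw] at h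
  exact h

theorem apply_mem_posSide_conj (hb : b ∉ wall r) :
    g x ∈ posSide (g b) (g * r * g⁻¹) ↔ x ∈ posSide b r := by
  rw [← image_posSide g hb, g.injective.mem_set_image]

theorem isOpen_posSide (hX : IsCAT0 X) (b : X) (r : X ≃ᵢ X) : IsOpen (posSide b r) := by
  have := hX.geodesic.locallyConnectedSpace
  exact (isClosed_wall r).isOpen_compl.connectedComponentIn

/-- A point in the closure of both sides is on the wall. -/
theorem mem_wall_of_mem_closure (hX : IsCAT0 X) {A : Set X}
    (hA : ∀ y ∈ A, y ∉ posSide b r) (h1 : x ∈ closure (posSide b r)) (h2 : x ∈ closure A) :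
    x ∈ wall r := by
  by_contra hx
  have hopen := isOpen_posSide hX x r
  have hxx := mem_posSide_self hx
  obtain ⟨y, hy1, hy2⟩ := mem_closure_iff.1 h1 _ hopen hxx
  obtain ⟨z, hz1, hz2⟩ := mem_closure_iff.1 h2 _ hopen hxx
  apply hA z hz2
  rw [posSide_eq_of_mem hy2, ← posSide_eq_of_mem hy1]
  exact hz1

namespace IsReflection

theorem mul_self (hr : IsReflection r) : r * r = 1 := by rw [← sq, hr.sq_eq_one]

theorem inv_eq (hr : IsReflection r) : r⁻¹ = r := inv_eq_of_mul_eq_one_left hr.mul_self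

theorem ne_one [Nonempty X] (hr : IsReflection r) : r ≠ 1 := by
  rintro rfl
  have h : wall (1 : X ≃ᵢ X) = Set.univ := Set.eq_univ_of_forall fun _ => rfl
  have := hr.interior_wall
  rw [h, interior_univ] at this
  exact Set.univ_nonempty.ne_empty this

theorem convex_posSide (hr : IsReflection r) (hb : b ∉ wall r) : IsGeodConvex (posSide b r) := by
  obtain ⟨A, B, -, hAB, hA, hB, -, -⟩ := hr.two_sides
  have h : posSide b r ∈ ({A, B} : Set (Set X)) := hAB ▸ ⟨b, hb, rfl⟩
  rcases h with h | h <;> rw [h] <;> assumption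

theorem apply_mem_posSide (hr : IsReflection r) (hb : b ∉ wall r) (hx : x ∉ wall r)
    (h : x ∉ posSide b r) : r x ∈ posSide b r := by
  obtain ⟨A, B, -, hAB, -, -, hrA, hrB⟩ := hr.two_sides
  have hb' : posSide b r ∈ ({A, B} : Set (Set X)) := hAB ▸ ⟨b, hb, rfl⟩
  have hx' : posSide x r ∈ ({A, B} : Set (Set X)) := hAB ▸ ⟨x, hx, rfl⟩
  have hxx := mem_posSide_self hx
  rcases hb' with hb' | hb' <;> rcases hx' with hx' | hx'
  · exact absurd (by rw [hb', ← hx']; exact hxx) h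
  · rw [hb', ← hrB, ← hx']; exact ⟨x, hxx, rfl⟩
  · rw [hb', ← hrA, ← hx']; exact ⟨x, hxx, rfl⟩
  · exact absurd (by rw [hb', show B = posSide x r from hx'.symm]; exact hxx) h

theorem apply_notMem_posSide (hr : IsReflection r) (hb : b ∉ wall r) (h : x ∈ posSide b r) :
    r x ∉ posSide b r := by
  intro h'
  obtain ⟨A, B, hne, hAB, -, -, hrA, hrB⟩ := hr.two_sides
  have hb' : posSide b r ∈ ({A, B} : Set (Set X)) := hAB ▸ ⟨b, hb, rfl⟩
  have hA : A ∈ {D : Set X | ∃ x ∈ (wall r)ᶜ, D = connectedComponentIn (wall r)ᶜ x} := by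
    rw [hAB]; exact Or.inl rfl
  have hB : B ∈ {D : Set X | ∃ x ∈ (wall r)ᶜ, D = connectedComponentIn (wall r)ᶜ x} := by
    rw [hAB]; exact Or.inr rfl
  obtain ⟨a, -, ha⟩ := hA
  obtain ⟨a', -, ha'⟩ := hB
  have key : r x ∈ A → r x ∈ B → False := fun h1 h2 => hne <| by
    rw [ha] at h1
    rw [ha'] at h2
    rw [ha, ha', connectedComponentIn_eq h1, connectedComponentIn_eq h2]
  rcases hb' with hb' | hb'
  · rw [hb'] at h h'
    exact key h' (hrA ▸ ⟨x, h, rfl⟩)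
  · rw [show posSide b r = B from hb'] at h h'
    exact key (hrB ▸ ⟨x, h, rfl⟩) h'

/-- Points off the wall exist arbitrarily near x, since the wall has empty interior; one on the
wrong side is reflected without changing its distance to the fixed point x. -/
theorem wall_subset_closure (hr : IsReflection r) (hb : b ∉ wall r) :
    wall r ⊆ closure (posSide b r) := by
  intro x hx
  rw [Metric.mem_closure_iff]
  intro ε hε
  have hnot : ¬ Metric.ball x ε ⊆ wall r := fun h => by
    have : x ∈ interior (wall r) := interior_mono h (by
      rw [Metric.isOpen_ball.interior_eq]; exact Metric.mem_ball_self hε)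
    rw [hr.interior_wall] at this
    exact this
  obtain ⟨y, hy, hyw⟩ := Set.not_subset.1 hnot
  rw [Metric.mem_ball, dist_comm] at hy
  by_cases h : y ∈ posSide b r
  · exact ⟨y, h, hy⟩
  · refine ⟨r y, hr.apply_mem_posSide hb hyw h, ?_⟩
    rwa [← show r x = x from hx, r.dist_eq]

theorem conj (hX : IsCAT0 X) (hr : IsReflection r) (g : X ≃ᵢ X) : IsReflection (g * r * g⁻¹) := by
  have hconv : ∀ A : Set X, IsGeodConvex A → IsGeodConvex (g '' A) := by
    rintro A hA _ ⟨x, hx, rfl⟩ _ ⟨y, hy, rfl⟩ z hz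
    refine ⟨g⁻¹ z, hA x hx y hy _ ?_, IsometryEquiv.apply_inv_self g z⟩
    rw [onGeodesic_iff hX.geodesic] at hz ⊢
    rw [← g.dist_eq x, ← g.dist_eq (g⁻¹ z), IsometryEquiv.apply_inv_self, hz, g.dist_eq]
  have hfun : ∀ A : Set X, (g * r * g⁻¹ : X ≃ᵢ X) '' (g '' A) = g '' (r '' A) := by
    intro A
    rw [Set.image_image, Set.image_image]
    refine Set.image_congr fun x _ => ?_
    change g (r (g⁻¹ (g x))) = _
    rw [IsometryEquiv.inv_apply_self]
  obtain ⟨A, B, hne, hAB, hA, hB, hrA, hrB⟩ := hr.two_sides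
  refine ⟨?_, ?_, g '' A, g '' B, fun h => hne (g.injective.image_injective h), ?_, hconv A hA,
    hconv B hB, by rw [hfun, hrA], by rw [hfun, hrB]⟩
  · rw [sq]
    calc g * r * g⁻¹ * (g * r * g⁻¹) = g * (r * r) * g⁻¹ := by group
      _ = 1 := by rw [hr.mul_self]; group
  · rw [← wall_conj]
    have := g.toHomeomorph.image_interior (wall r)
    rw [hr.interior_wall, Set.image_empty] at this
    exact this.symm
  · rw [← Set.image_pair (fun D : Set X => g '' D), ← hAB]
    ext D
    constructor
    · rintro ⟨x, hx, rfl⟩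
      have hx' : g⁻¹ x ∉ wall r := fun h => hx <| by
        rwa [← apply_mem_wall_conj (g := g), IsometryEquiv.apply_inv_self] at h
      refine ⟨_, ⟨g⁻¹ x, hx', rfl⟩, ?_⟩
      have := image_posSide g hx'
      rwa [IsometryEquiv.apply_inv_self] at this
    · rintro ⟨_, ⟨x, hx, rfl⟩, rfl⟩
      exact ⟨g x, fun h => hx (apply_mem_wall_conj.1 h), image_posSide g hx⟩

/-- A geodesic leaving a side of the wall meets the wall. -/
theorem exists_between_mem_wall (hX : IsCAT0 X) (h : y ∉ posSide b r) (hx : x ∈ posSide b r) :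
    ∃ z ∈ wall r, dist x z + dist z y = dist x y := by
  by_contra! hcon
  apply h
  rw [posSide_eq_of_mem hx]
  exact hX.geodesic.mem_connectedComponentIn fun z hz hzw => hcon z hzw hz

/-- Reflecting a point of the other side brings it closer. -/
theorem dist_apply_lt (hX : IsCAT0 X) (hr : IsReflection r) (hb : b ∉ wall r) (hy : y ∉ wall r)
    (h : y ∉ posSide b r) : dist b (r y) < dist b y := by
  obtain ⟨z, hz, hbz⟩ := exists_between_mem_wall hX h (mem_posSide_self hb)
  have hzy : dist z (r y) = dist z y := by
    conv_lhs => rw [← show r z = z from hz, r.dist_eq]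
  -- In case of equality, the wall point z would lie on a geodesic from b to r y, which stays in the
  -- convex side of b.
  refine lt_of_le_of_ne ?_ fun heq => ?_
  · linarith [dist_triangle b z (r y)]
  · refine notMem_wall_of_mem_posSide (hr.convex_posSide hb b (mem_posSide_self hb) (r y)
      (hr.apply_mem_posSide hb hy h) z ?_) hz
    rw [onGeodesic_iff hX.geodesic, hzy, hbz, heq]

end IsReflection

/-- Walls are convex. -/
theorem mem_wall_of_between (hX : IsCAT0 X) {z : X} (hx : x ∈ wall r) (hy : y ∈ wall r)
    (hz : dist x z + dist z y = dist x y) : z ∈ wall r := by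
  have h1 : dist x (r z) = dist x z := by
    conv_lhs => rw [← show r x = x from hx, r.dist_eq]
  have h2 : dist (r z) y = dist z y := by
    conv_lhs => rw [← show r y = y from hy, r.dist_eq]
  exact hX.eq_of_dist_eq (by rw [h1, h2, hz]) hz h1

end Reflections

/-! ### Chambers and the simply transitive action of W on them. -/

section ReflectionGroups

variable {X : Type*} [MetricSpace X] {W : Subgroup (X ≃ᵢ X)} {r g : X ≃ᵢ X} {b x y : X}

theorem notMem_wall_of_mem_wallComplement (hx : x ∈ wallComplement W) (hr : r ∈ reflections W) :
    x ∉ wall r := fun h => hx (Set.mem_biUnion hr h)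

theorem mem_wallComplement_iff : x ∈ wallComplement W ↔ ∀ r ∈ reflections W, x ∉ wall r := by
  simp [wallComplement]

theorem conj_mem_reflections (hX : IsCAT0 X) (hg : g ∈ W) (hr : r ∈ reflections W) :
    g * r * g⁻¹ ∈ reflections W :=
  ⟨W.mul_mem (W.mul_mem hg hr.1) (W.inv_mem hg), hr.2.conj hX g⟩

theorem apply_mem_wallComplement (hX : IsCAT0 X) (hg : g ∈ W) (hx : x ∈ wallComplement W) :
    g x ∈ wallComplement W := by
  rw [mem_wallComplement_iff] at hx ⊢
  intro r hr h
  refine hx (g⁻¹ * r * g⁻¹⁻¹) (conj_mem_reflections hX (W.inv_mem hg) hr) ?_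
  rwa [← apply_mem_wall_conj (g := g⁻¹), IsometryEquiv.inv_apply_self] at h

theorem image_wallComplement (hX : IsCAT0 X) (hg : g ∈ W) :
    g '' wallComplement W = wallComplement W := by
  ext x
  constructor
  · rintro ⟨y, hy, rfl⟩
    exact apply_mem_wallComplement hX hg hy
  · exact fun hx => ⟨g⁻¹ x, apply_mem_wallComplement hX (W.inv_mem hg) hx,
      IsometryEquiv.apply_inv_self g x⟩

theorem image_chamber (hX : IsCAT0 X) (hg : g ∈ W) (hx : x ∈ wallComplement W) :
    g '' chamber W x = chamber W (g x) := by
  have h := g.toHomeomorph.image_connectedComponentIn hx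
  have hw : g.toHomeomorph '' wallComplement W = wallComplement W := image_wallComplement hX hg
  rw [hw] at h
  exact h

theorem chamber_eq_of_mem (h : y ∈ chamber W x) : chamber W x = chamber W y :=
  connectedComponentIn_eq h

theorem mem_chamber_self (hx : x ∈ wallComplement W) : x ∈ chamber W x :=
  mem_connectedComponentIn hx

theorem chamber_subset_posSide (hr : r ∈ reflections W) :
    chamber W x ⊆ posSide x r :=
  connectedComponentIn_mono _ fun _ h => notMem_wall_of_mem_wallComplement h hr

/-- The sides are convex, so a geodesic between two points in front of all walls avoids every wall
and the points share a chamber. -/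
theorem mem_chamber_iff (hX : IsCAT0 X) (hx : x ∈ wallComplement W) :
    y ∈ chamber W x ↔ ∀ r ∈ reflections W, y ∈ posSide x r := by
  refine ⟨fun h r hr => chamber_subset_posSide hr h, fun h => ?_⟩
  refine hX.geodesic.mem_connectedComponentIn fun z hz => mem_wallComplement_iff.2 fun r hr => ?_
  have hxr := notMem_wall_of_mem_wallComplement hx hr
  exact notMem_wall_of_mem_posSide (hr.2.convex_posSide hxr x (mem_posSide_self hxr) y (h r hr) z
    ((onGeodesic_iff hX.geodesic).2 hz))

namespace IsCocompactDiscreteReflectionGroup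

theorem finite_dist_le (hW : IsCocompactDiscreteReflectionGroup W) (b y : X) (N : ℝ) :
    {g : X ≃ᵢ X | g ∈ W ∧ dist b (g y) ≤ N}.Finite := by
  refine (hW.proper y (max N 0 + dist b y + 1) (by positivity)).subset fun g hg => ⟨hg.1, ?_⟩
  rw [Metric.mem_ball]
  linarith [hg.2, le_max_left N 0, dist_triangle (g y) b y, dist_comm (g y) b]

/-- Every orbit of a set of elements of `W` has a point closest to `b`. -/
theorem exists_min_dist (hW : IsCocompactDiscreteReflectionGroup W) {V : Set (X ≃ᵢ X)}
    (hV : ∀ g ∈ V, g ∈ W) (hne : V.Nonempty) (b y : X) :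
    ∃ g ∈ V, ∀ h ∈ V, dist b (g y) ≤ dist b (h y) := by
  obtain ⟨h₀, h₀V⟩ := hne
  have hfin : {g | g ∈ V ∧ dist b (g y) ≤ dist b (h₀ y)}.Finite :=
    (hW.finite_dist_le b y _).subset fun g hg => ⟨hV g hg.1, hg.2⟩
  obtain ⟨g, hg, hmin⟩ := Set.exists_min_image _ (fun g : X ≃ᵢ X => dist b (g y)) hfin
    ⟨h₀, h₀V, le_rfl⟩
  refine ⟨g, hg.1, fun h hh => ?_⟩
  by_cases hle : dist b (h y) ≤ dist b (h₀ y)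
  · exact hmin h ⟨hh, hle⟩
  · exact hg.2.trans (not_le.1 hle).le

/-- Take the orbit point nearest to b: a wall separating it from b would yield, by reflection, a
nearer one. -/
theorem exists_apply_mem_chamber (hX : IsCAT0 X) (hW : IsCocompactDiscreteReflectionGroup W)
    (hb : b ∈ wallComplement W) (hy : y ∈ wallComplement W) : ∃ g ∈ W, g y ∈ chamber W b := by
  obtain ⟨g, hg, hmin⟩ := hW.exists_min_dist (V := W) (fun _ h => h) ⟨1, W.one_mem⟩ b y
  refine ⟨g, hg, (mem_chamber_iff hX hb).2 fun r hr => ?_⟩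
  by_contra hcon
  exact (hr.2.dist_apply_lt hX (notMem_wall_of_mem_wallComplement hb hr)
    (notMem_wall_of_mem_wallComplement (apply_mem_wallComplement hX hg hy) hr) hcon).not_ge
    (hmin (r * g) (W.mul_mem hr.1 hg))

/-- Trivial stabilizer is assumed for one chamber only; transitivity and conjugation carry it to
every chamber. -/
theorem eq_one_of_apply_mem_chamber (hX : IsCAT0 X) (hW : IsCocompactDiscreteReflectionGroup W)
    (hb : b ∈ wallComplement W) (hg : g ∈ W) (h : g b ∈ chamber W b) : g = 1 := by
  obtain ⟨y, hy, -, hstab⟩ := hW.cocompact_discrete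
  obtain ⟨w, hw, hwb⟩ := hW.exists_apply_mem_chamber hX hy hb
  have h1 : w (g b) ∈ chamber W y := by
    rw [chamber_eq_of_mem hwb, ← image_chamber hX hw hb]
    exact ⟨_, h, rfl⟩
  have h2 := hstab (w * g * w⁻¹) (W.mul_mem (W.mul_mem hw hg) (W.inv_mem hw)) (by
    conv_lhs => rw [chamber_eq_of_mem hwb]
    rw [image_chamber hX (W.mul_mem (W.mul_mem hw hg) (W.inv_mem hw))
      (apply_mem_wallComplement hX hw hb), chamber_eq_of_mem h1]
    change chamber W (w (g (w⁻¹ (w b)))) = _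
    rw [IsometryEquiv.inv_apply_self])
  have h3 : g = w⁻¹ * (w * g * w⁻¹) * w := by group
  rw [h3, h2]
  group

theorem isCompact_closure_chamber (hX : IsCAT0 X) (hW : IsCocompactDiscreteReflectionGroup W)
    (hb : b ∈ wallComplement W) : IsCompact (closure (chamber W b)) := by
  obtain ⟨y, hy, hc, -⟩ := hW.cocompact_discrete
  obtain ⟨w, hw, hwy⟩ := hW.exists_apply_mem_chamber hX hb hy
  rw [chamber_eq_of_mem hwy, ← image_chamber hX hw hy]
  have := w.toHomeomorph.image_closure (chamber W y)
  change w '' closure (chamber W y) = closure (w '' chamber W y) at this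
  rw [← this]
  exact hc.image w.continuous

/-- The complement of the walls is dense. -/
theorem dense_wallComplement (hW : IsCocompactDiscreteReflectionGroup W) :
    Dense (wallComplement W) := by
  intro x
  rw [Metric.mem_closure_iff]
  intro ε hε
  -- A wall meeting the ε-ball about x moves x by at most 2ε, so only finitely many walls matter and
  -- a finite intersection of dense open sets suffices.
  let T : Set (X ≃ᵢ X) := {r | r ∈ reflections W ∧ dist x (r x) ≤ 2 * ε}
  have hT : T.Finite := (hW.finite_dist_le x x (2 * ε)).subset fun r hr => ⟨hr.1.1, hr.2⟩
  have hd : Dense (⋂₀ ((fun r => (wall r)ᶜ) '' T)) := by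
    refine (hT.image _).dense_sInter ?_ ?_
    · rintro _ ⟨r, -, rfl⟩
      exact (isClosed_wall r).isOpen_compl
    · rintro _ ⟨r, hr, rfl⟩
      exact interior_eq_empty_iff_dense_compl.1 hr.1.2.interior_wall
  obtain ⟨y, hy, hxy⟩ := Metric.mem_closure_iff.1 (hd x) ε hε
  refine ⟨y, mem_wallComplement_iff.2 fun r hr hyr => ?_, hxy⟩
  refine hy _ ⟨r, ⟨hr, ?_⟩, rfl⟩ hyr
  have h1 : dist y (r x) = dist y x := by
    conv_lhs => rw [← show r y = y from hyr, r.dist_eq]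
  linarith [dist_triangle x y (r x), dist_comm x y]

end IsCocompactDiscreteReflectionGroup

end ReflectionGroups

/-! ### Faces of the chamber, the exchange condition and word length. -/

section MinimalReflectionSets

variable {X : Type*} [MetricSpace X] {W : Subgroup (X ≃ᵢ X)} {S : Set (X ≃ᵢ X)}
  {r s t w : X ≃ᵢ X} {b x y z : X}

/-- A point has a neighbourhood meeting only walls through that point. -/
theorem IsCocompactDiscreteReflectionGroup.exists_ball_disjoint
    (hW : IsCocompactDiscreteReflectionGroup W) (z : X) :
    ∃ ε > 0, ∀ r ∈ reflections W, r z ≠ z → Disjoint (Metric.ball z ε) (wall r) := by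
  -- A reflection whose wall meets the ball of radius 1/2 about z moves z by at most 1, so T is
  -- finite by properness.
  let T : Set (X ≃ᵢ X) := {r | (r ∈ W ∧ dist z (r z) ≤ 1) ∧ r z ≠ z}
  have hT : T.Finite := (hW.finite_dist_le z z 1).subset fun r hr => hr.1
  have hopen : IsOpen (⋂ r ∈ T, (wall r)ᶜ) :=
    hT.isOpen_biInter fun r _ => (isClosed_wall r).isOpen_compl
  obtain ⟨ε, hε, hball⟩ := Metric.isOpen_iff.1 hopen z (Set.mem_iInter₂.2 fun r hr => hr.2)
  refine ⟨min ε (1 / 2), by positivity, fun r hr hrz => Set.disjoint_left.2 fun y hy hyr => ?_⟩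
  rw [Metric.mem_ball, lt_min_iff] at hy
  have h1 : dist y (r z) = dist y z := by
    conv_lhs => rw [← show r y = y from hyr, r.dist_eq]
  have hrT : r ∈ T := ⟨⟨hr.1, by linarith [dist_triangle z y (r z), dist_comm z y, hy.2]⟩, hrz⟩
  exact Set.mem_iInter₂.1 (hball hy.1) r hrT hyr

namespace IsMinimalReflectionSet

theorem isReflection (hS : IsMinimalReflectionSet W b S) (hs : s ∈ S) : IsReflection s :=
  (hS.subset_reflections hs).2

theorem mem (hS : IsMinimalReflectionSet W b S) (hs : s ∈ S) : s ∈ W :=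
  (hS.subset_reflections hs).1

theorem notMem_wall (hS : IsMinimalReflectionSet W b S) (hb : b ∈ wallComplement W) (hs : s ∈ S) :
    b ∉ wall s :=
  notMem_wall_of_mem_wallComplement hb (hS.subset_reflections hs)

theorem mem_chamber_iff (hS : IsMinimalReflectionSet W b S) :
    y ∈ chamber W b ↔ ∀ s ∈ S, y ∈ posSide b s := by
  rw [hS.chamber_eq, Set.mem_iInter₂]

theorem closure_le (hS : IsMinimalReflectionSet W b S) : Subgroup.closure S ≤ W :=
  (Subgroup.closure_le W).2 fun _ hs => hS.mem hs

/-- The nearest-point argument again, inside the subgroup generated by S: since S cuts out the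
chamber, only reflections in S are needed to bring w b back to it. -/
theorem closure_eq (hX : IsCAT0 X) (hW : IsCocompactDiscreteReflectionGroup W)
    (hb : b ∈ wallComplement W) (hS : IsMinimalReflectionSet W b S) : Subgroup.closure S = W := by
  refine le_antisymm hS.closure_le fun w hw => ?_
  have hwb := apply_mem_wallComplement hX hw hb
  obtain ⟨g, hg, hmin⟩ := hW.exists_min_dist (V := (Subgroup.closure S : Set (X ≃ᵢ X)))
    (fun _ h => hS.closure_le h) ⟨1, Subgroup.one_mem _⟩ b (w b)
  have hgw := apply_mem_wallComplement hX (hS.closure_le hg) hwb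
  have hC : g (w b) ∈ chamber W b := by
    refine hS.mem_chamber_iff.2 fun s hs => ?_
    by_contra hcon
    exact ((hS.isReflection hs).dist_apply_lt hX (hS.notMem_wall hb hs)
      (notMem_wall_of_mem_wallComplement hgw (hS.subset_reflections hs)) hcon).not_ge
      (hmin (s * g) (Subgroup.mul_mem _ (Subgroup.subset_closure hs) hg))
  have h1 := hW.eq_one_of_apply_mem_chamber hX hb (g := g * w)
    (W.mul_mem (hS.closure_le hg) hw) hC
  rw [eq_inv_of_mul_eq_one_right h1]
  exact Subgroup.inv_mem _ hg

/-- The wall of `s ∈ S` contains a point which is inside all other half-spaces. -/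
theorem exists_mem_wall (hX : IsCAT0 X) (hb : b ∈ wallComplement W)
    (hS : IsMinimalReflectionSet W b S) (hs : s ∈ S) :
    ∃ z ∈ wall s, ∀ t ∈ S, t ≠ s → z ∈ posSide b t := by
  -- Minimality of S provides y outside the chamber but in front of all walls except that of s; the
  -- geodesic from b to y crosses the wall of s at the desired point.
  have hsub : ¬ (⋂ t ∈ S \ {s}, posSide b t) ⊆ chamber W b := fun h =>
    hS.minimal s hs (Set.Subset.antisymm (fun y hy => Set.mem_iInter₂.2 fun t ht =>
      hS.mem_chamber_iff.1 hy t ht.1) h)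
  obtain ⟨y, hy, hyC⟩ := Set.not_subset.1 hsub
  have hy' : ∀ t ∈ S, t ≠ s → y ∈ posSide b t := fun t ht hts => Set.mem_iInter₂.1 hy t ⟨ht, hts⟩
  have hys : y ∉ posSide b s := fun h => hyC <| hS.mem_chamber_iff.2 fun t ht => by
    by_cases hts : t = s
    · rwa [hts]
    · exact hy' t ht hts
  obtain ⟨z, hz, hbz⟩ := IsReflection.exists_between_mem_wall hX hys
    (mem_posSide_self (hS.notMem_wall hb hs))
  refine ⟨z, hz, fun t ht hts => ?_⟩
  exact (hS.isReflection ht).convex_posSide (hS.notMem_wall hb ht) b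
    (mem_posSide_self (hS.notMem_wall hb ht)) y (hy' t ht hts) z
    ((onGeodesic_iff hX.geodesic).2 hbz)

/-- A single radius serves all t, without finiteness of S, because local finiteness concerns all
walls at once. -/
theorem exists_ball_subset (hX : IsCAT0 X) (hW : IsCocompactDiscreteReflectionGroup W)
    (hS : IsMinimalReflectionSet W b S)
    (hz : ∀ t ∈ S, t ≠ s → z ∈ posSide b t) :
    ∃ ε > 0, ∀ t ∈ S, t ≠ s → Metric.ball z ε ⊆ posSide b t := by
  obtain ⟨ε, hε, h⟩ := hW.exists_ball_disjoint z
  refine ⟨ε, hε, fun t ht hts y hy => ?_⟩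
  have hzt := hz t ht hts
  rw [posSide_eq_of_mem hzt]
  refine hX.geodesic.mem_connectedComponentIn fun x hx hxt => ?_
  refine Set.disjoint_left.1 (h t (hS.subset_reflections ht) (notMem_wall_of_mem_posSide hzt))
    ?_ hxt
  rw [Metric.mem_ball, dist_comm] at hy ⊢
  linarith [dist_nonneg (x := x) (y := y)]

theorem mem_closure_chamber (hX : IsCAT0 X) (hW : IsCocompactDiscreteReflectionGroup W)
    (hb : b ∈ wallComplement W) (hS : IsMinimalReflectionSet W b S) (hs : s ∈ S)
    (hzs : z ∈ wall s) (hz : ∀ t ∈ S, t ≠ s → z ∈ posSide b t) : z ∈ closure (chamber W b) := by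
  obtain ⟨ε, hε, hball⟩ := hS.exists_ball_subset hX hW hz
  rw [mem_closure_iff_nhds]
  intro U hU
  obtain ⟨q, ⟨hqU, hqb⟩, hqs⟩ := mem_closure_iff_nhds.1
    ((hS.isReflection hs).wall_subset_closure (hS.notMem_wall hb hs) hzs) _
    (Filter.inter_mem hU (Metric.ball_mem_nhds z hε))
  refine ⟨q, hqU, hS.mem_chamber_iff.2 fun t ht => ?_⟩
  by_cases hts : t = s
  · rwa [hts]
  · exact hball t ht hts hqb

/-- The only reflection fixing an interior point of a face of the chamber is the reflection in
that face. -/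
theorem eq_of_apply_eq (hX : IsCAT0 X) (hW : IsCocompactDiscreteReflectionGroup W)
    (hb : b ∈ wallComplement W) (hS : IsMinimalReflectionSet W b S) (hs : s ∈ S)
    (hzs : z ∈ wall s) (hz : ∀ t ∈ S, t ≠ s → z ∈ posSide b t) (hr : r ∈ reflections W)
    (hrz : r z = z) : r = s := by
  obtain ⟨ε, hε, hball⟩ := hS.exists_ball_subset hX hW hz
  obtain ⟨q, hqC, hqz⟩ := Metric.mem_closure_iff.1 (hS.mem_closure_chamber hX hW hb hs hzs hz) ε hε
  have hball_apply : ∀ g : X ≃ᵢ X, g z = z → ∀ p ∈ Metric.ball z ε, g p ∈ Metric.ball z ε := by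
    intro g hg p hp
    rw [Metric.mem_ball] at hp ⊢
    rwa [← g.dist_eq, hg] at hp
  rw [dist_comm] at hqz
  have hq : q ∈ wallComplement W := connectedComponentIn_subset _ _ hqC
  -- An element fixing z keeps q in the small ball, so only the wall of s can separate its image
  -- from the chamber. As r q is then behind s, the element s r satisfies this criterion, hence s r
  -- = 1.
  have key : ∀ g ∈ W, g z = z → g q ∈ posSide b s → g = 1 := fun g hg hgz hgs => by
    refine hW.eq_one_of_apply_mem_chamber hX hq hg ?_
    rw [← chamber_eq_of_mem hqC, hS.mem_chamber_iff]
    intro t ht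
    by_cases hts : t = s
    · rwa [hts]
    · exact hball t ht hts (hball_apply g hgz q hqz)
  have : Nonempty X := ⟨z⟩
  have hrq := hball_apply r hrz q hqz
  have hrs : r q ∉ posSide b s := fun h => hr.2.ne_one (key r hr.1 hrz h)
  have h1 := key (s * r) (W.mul_mem (hS.mem hs) hr.1) (by
    change s (r z) = z
    rw [hrz, show s z = z from hzs]) ((hS.isReflection hs).apply_mem_posSide (hS.notMem_wall hb hs)
      (notMem_wall_of_mem_wallComplement (apply_mem_wallComplement hX hr.1 hq)
        (hS.subset_reflections hs)) hrs)
  rw [eq_inv_of_mul_eq_one_right h1, (hS.isReflection hs).inv_eq]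

/-- The only wall separating a chamber from its image under `s` is the wall of `s`. -/
theorem eq_of_apply_notMem_posSide (hX : IsCAT0 X) (hW : IsCocompactDiscreteReflectionGroup W)
    (hb : b ∈ wallComplement W) (hS : IsMinimalReflectionSet W b S) (hs : s ∈ S)
    (hr : r ∈ reflections W) (h : s b ∉ posSide b r) : r = s := by
  obtain ⟨z, hzs, hz⟩ := hS.exists_mem_wall hX hb hs
  have hzC := hS.mem_closure_chamber hX hW hb hs hzs hz
  refine hS.eq_of_apply_eq hX hW hb hs hzs hz hr ?_
  -- The face point z is in the closure of both C and sC, which r separates, so z is on the wall of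
  -- r.
  refine mem_wall_of_mem_closure hX (b := b) (A := chamber W (s b)) (fun y hy hyr => h ?_)
    (closure_mono (chamber_subset_posSide hr) hzC) ?_
  · rw [posSide_eq_of_mem hyr, ← posSide_eq_of_mem (chamber_subset_posSide hr hy)]
    exact mem_posSide_self (notMem_wall_of_mem_wallComplement
      (apply_mem_wallComplement hX (hS.mem hs) hb) hr)
  · rw [← image_chamber hX (hS.mem hs) hb, ← show s z = z from hzs]
    have := s.toHomeomorph.image_closure (chamber W b)
    change s '' closure (chamber W b) = closure (s '' chamber W b) at this
    rw [← this]
    exact ⟨z, hzC, rfl⟩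

theorem prod_mem (hS : IsMinimalReflectionSet W b S) {l : List (X ≃ᵢ X)} (hl : ∀ x ∈ l, x ∈ S) :
    l.prod ∈ W :=
  W.list_prod_mem fun x hx => hS.mem (hl x hx)

/-- The exchange condition. -/
theorem exchange (hX : IsCAT0 X) (hW : IsCocompactDiscreteReflectionGroup W)
    (hb : b ∈ wallComplement W) (hS : IsMinimalReflectionSet W b S) (hs : s ∈ S) :
    ∀ l : List (X ≃ᵢ X), (∀ x ∈ l, x ∈ S) → l.prod⁻¹ b ∉ posSide b s →
      ∃ i < l.length, l.prod * s = (l.eraseIdx i).prod := by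
  intro l
  induction l with
  | nil =>
    intro _ h
    rw [List.prod_nil, inv_one] at h
    exact absurd (mem_posSide_self (hS.notMem_wall hb hs)) h
  | cons x l ih =>
    intro hl h
    have hl' : ∀ y ∈ l, y ∈ S := fun y hy => hl y (List.mem_cons_of_mem _ hy)
    have hx : x ∈ S := hl x List.mem_cons_self
    -- If the suffix l is still in front of s, prepending x makes the crossing: the conjugate of s
    -- by `l.prod` separates b from x b, hence equals x, and x is the letter to delete.
    by_cases hls : l.prod⁻¹ b ∈ posSide b s
    · refine ⟨0, Nat.succ_pos _, ?_⟩
      have hlW := hS.prod_mem hl'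
      have hrx : l.prod * s * l.prod⁻¹ = x := by
        refine hS.eq_of_apply_notMem_posSide hX hW hb hx
          (conj_mem_reflections hX hlW (hS.subset_reflections hs)) fun hcon => h ?_
        have h1 := apply_mem_posSide_conj (g := l.prod) (r := s) (b := l.prod⁻¹ b)
          (x := l.prod⁻¹ (x b)) (notMem_wall_of_mem_posSide hls)
        rw [IsometryEquiv.apply_inv_self, IsometryEquiv.apply_inv_self,
          ← posSide_eq_of_mem hls] at h1
        rw [List.prod_cons, mul_inv_rev, (hS.isReflection hx).inv_eq]
        exact h1.1 hcon
      have h2 : l.prod * s = x * l.prod := by rw [← hrx]; group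
      rw [List.prod_cons, mul_assoc, h2, ← mul_assoc, (hS.isReflection hx).mul_self, one_mul]
      rfl
    · obtain ⟨i, hi, h1⟩ := ih hl' hls
      refine ⟨i + 1, Nat.succ_lt_succ hi, ?_⟩
      rw [List.prod_cons, mul_assoc, h1, List.eraseIdx_cons_succ, List.prod_cons]

theorem exists_list (hX : IsCAT0 X) (hW : IsCocompactDiscreteReflectionGroup W)
    (hb : b ∈ wallComplement W) (hS : IsMinimalReflectionSet W b S) (hw : w ∈ W) :
    ∃ l : List (X ≃ᵢ X), (∀ x ∈ l, x ∈ S) ∧ l.prod = w := by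
  rw [← hS.closure_eq hX hW hb, ← Subgroup.mem_toSubmonoid, Subgroup.closure_toSubmonoid] at hw
  obtain ⟨l, hl, hlw⟩ := Submonoid.exists_list_of_mem_closure hw
  refine ⟨l, fun x hx => ?_, hlw⟩
  rcases hl x hx with h | h
  · exact h
  · rw [← inv_inv x, (hS.isReflection h).inv_eq]
    exact h

theorem exists_list_length_eq (hX : IsCAT0 X) (hW : IsCocompactDiscreteReflectionGroup W)
    (hb : b ∈ wallComplement W) (hS : IsMinimalReflectionSet W b S) (hw : w ∈ W) :
    ∃ l : List (X ≃ᵢ X), (∀ x ∈ l, x ∈ S) ∧ l.prod = w ∧ l.length = wordLength S w := by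
  obtain ⟨l, hl, hlw⟩ := hS.exists_list hX hW hb hw
  exact Nat.sInf_mem (s := {n | ∃ l : List (X ≃ᵢ X), (∀ s ∈ l, s ∈ S) ∧ l.prod = w ∧ l.length = n})
    ⟨_, l, hl, hlw, rfl⟩

/-- Otherwise the exchange condition deletes a letter from a shortest word for w and makes w s
shorter than w. -/
theorem inv_apply_mem_posSide (hX : IsCAT0 X) (hW : IsCocompactDiscreteReflectionGroup W)
    (hb : b ∈ wallComplement W) (hS : IsMinimalReflectionSet W b S) (hw : w ∈ W) (hs : s ∈ S)
    (h : wordLength S w < wordLength S (w * s)) : w⁻¹ b ∈ posSide b s := by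
  by_contra hcon
  obtain ⟨l, hl, rfl, hlen⟩ := hS.exists_list_length_eq hX hW hb hw
  obtain ⟨i, hi, hls⟩ := hS.exchange hX hW hb hs l hl hcon
  have h1 : wordLength S (l.prod * s) ≤ (l.eraseIdx i).length :=
    Nat.sInf_le ⟨_, fun x hx => hl x (List.eraseIdx_subset hx), hls.symm, rfl⟩
  rw [List.length_eraseIdx_of_lt hi] at h1
  omega

/-- If `w⁻¹ C` is on the same side of the walls of `s` and `t` as `C` then it is the element of its
orbit under `⟨s, t⟩` nearest to `C`, so `t w⁻¹ C` is on the same side of the wall of `s` too. -/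
theorem mul_inv_apply_mem_posSide (hX : IsCAT0 X) (hW : IsCocompactDiscreteReflectionGroup W)
    (hb : b ∈ wallComplement W) (hS : IsMinimalReflectionSet W b S) (hw : w ∈ W) (hs : s ∈ S)
    (ht : t ∈ S) (hst : s ≠ t) (hws : w⁻¹ b ∈ posSide b s) (hwt : w⁻¹ b ∈ posSide b t) :
    t (w⁻¹ b) ∈ posSide b s := by
  classical
  have hpair : ∀ x : X ≃ᵢ X, x = s ∨ x = t → x ∈ S ∧ w⁻¹ b ∈ posSide b x := by
    rintro x (rfl | rfl)
    exacts [⟨hs, hws⟩, ⟨ht, hwt⟩]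
  -- Factor w as a word e in S times a word q in s and t, with the pair of lengths lexicographically
  -- minimal. This e represents the shortest element of the coset w⟨s, t⟩.
  let P : ℕ → ℕ → Prop := fun m n => ∃ e q : List (X ≃ᵢ X), (∀ x ∈ e, x ∈ S) ∧
    (∀ x ∈ q, x = s ∨ x = t) ∧ w = e.prod * q.prod ∧ e.length = m ∧ q.length = n
  have hP : ∃ m n, P m n := by
    obtain ⟨l, hl, hlw⟩ := hS.exists_list hX hW hb hw
    exact ⟨_, 0, l, [], hl, by simp, by simp [hlw], rfl, rfl⟩
  obtain ⟨e, q, he, hq, heq, hem, hqn⟩ := Nat.find_spec (Nat.find_spec hP)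
  have hmin1 : ∀ e' q' : List (X ≃ᵢ X), (∀ x ∈ e', x ∈ S) → (∀ x ∈ q', x = s ∨ x = t) →
      w = e'.prod * q'.prod → e.length ≤ e'.length := fun e' q' h1 h2 h3 => by
    rw [hem]
    exact Nat.find_min' hP ⟨_, e', q', h1, h2, h3, rfl, rfl⟩
  have hmin2 : ∀ q' : List (X ≃ᵢ X), (∀ x ∈ q', x = s ∨ x = t) →
      w = e.prod * q'.prod → q.length ≤ q'.length := fun q' h2 h3 => by
    rw [hqn]
    exact Nat.find_min' (Nat.find_spec hP) ⟨e, q', he, h2, h3, hem, rfl⟩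
  have hsub : ∀ {l : List (X ≃ᵢ X)} {i : ℕ} {Q : (X ≃ᵢ X) → Prop}, (∀ x ∈ l, Q x) →
      ∀ x ∈ l.eraseIdx i, Q x := fun h x hx => h x (List.eraseIdx_subset hx)
  -- If q ended in x, exchange applied to w x would give w with a letter of e, or of the rest of q,
  -- deleted, against minimality.
  have hq0 : q = [] := by
    rcases List.eq_nil_or_concat q with h | ⟨q', x, rfl⟩
    · exact h
    exfalso
    rw [List.concat_eq_append] at hq heq hmin2
    have hx : x = s ∨ x = t := hq x (by simp)
    have hq' : ∀ y ∈ q', y = s ∨ y = t := fun y hy => hq y (by simp [hy])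
    obtain ⟨hxS, hxw⟩ := hpair x hx
    have hxr := hS.isReflection hxS
    have hwx : (e ++ q').prod = w * x := by
      rw [heq, List.prod_append, List.prod_append, List.prod_singleton, mul_assoc, mul_assoc,
        hxr.mul_self, mul_one]
    obtain ⟨i, hi, hex⟩ := hS.exchange hX hW hb hxS (e ++ q') (by
      intro y hy
      rcases List.mem_append.1 hy with hy | hy
      exacts [he y hy, (hpair y (hq' y hy)).1]) (by
      rw [hwx, mul_inv_rev, hxr.inv_eq]
      exact hxr.apply_notMem_posSide (hS.notMem_wall hb hxS) hxw)
    rw [hwx, mul_assoc, hxr.mul_self, mul_one] at hex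
    by_cases hie : i < e.length
    · rw [List.eraseIdx_append_of_lt_length hie, List.prod_append] at hex
      have := hmin1 _ _ (hsub he) hq' hex
      rw [List.length_eraseIdx_of_lt hie] at this
      omega
    · rw [List.eraseIdx_append_of_length_le (not_lt.1 hie), List.prod_append] at hex
      have := hmin2 _ (hsub hq') hex
      have h2 := List.length_eraseIdx_le q' (i - e.length)
      rw [List.length_append, List.length_singleton] at this
      omega
  rw [hq0, List.prod_nil, mul_one] at heq
  by_contra hcon
  have htr := hS.isReflection ht
  have hwt' : (e ++ [t]).prod = w * t := by rw [List.prod_append, List.prod_singleton, heq]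
  obtain ⟨i, hi, hex⟩ := hS.exchange hX hW hb hs (e ++ [t]) (by
    intro y hy
    rcases List.mem_append.1 hy with hy | hy
    exacts [he y hy, List.mem_singleton.1 hy ▸ ht]) (by
    rw [hwt', mul_inv_rev, htr.inv_eq]
    exact hcon)
  rw [hwt'] at hex
  by_cases hie : i < e.length
  · rw [List.eraseIdx_append_of_lt_length hie, List.prod_append, List.prod_singleton] at hex
    -- Here w t s = e' t, so w = e' t s t with e' shorter than e.
    have := hmin1 (e.eraseIdx i) [t, s, t] (hsub he) (by simp) (by
      rw [List.prod_cons, List.prod_cons, List.prod_singleton, ← mul_assoc, ← hex]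
      rw [mul_assoc (w * t), ← mul_assoc s, (hS.isReflection hs).mul_self, one_mul, mul_assoc,
        htr.mul_self, mul_one])
    rw [List.length_eraseIdx_of_lt hie] at this
    omega
  · rw [List.length_append, List.length_singleton] at hi
    rw [List.eraseIdx_append_of_length_le (not_lt.1 hie),
      show i - e.length = 0 by omega, List.eraseIdx_zero, List.tail_cons, List.append_nil, ← heq,
      mul_assoc] at hex
    have h1 : t * s = 1 := mul_eq_left.1 hex
    exact hst (by rw [eq_inv_of_mul_eq_one_right h1, htr.inv_eq])

end IsMinimalReflectionSet

end MinimalReflectionSets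

/-! ### Orbits of W, and geodesics forced through the chamber. -/

section CoarseGeometry

variable {X : Type*} [MetricSpace X] {W : Subgroup (X ≃ᵢ X)} {S : Set (X ≃ᵢ X)}
  {s t u v w : X ≃ᵢ X} {b x y z p : X}

namespace IsCocompactDiscreteReflectionGroup

theorem exists_dist_chamber_le (hX : IsCAT0 X) (hW : IsCocompactDiscreteReflectionGroup W)
    (hb : b ∈ wallComplement W) : ∃ K, ∀ x ∈ closure (chamber W b), dist x b ≤ K := by
  obtain ⟨K, hK⟩ := Metric.isBounded_iff.1 (hW.isCompact_closure_chamber hX hb).isBounded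
  exact ⟨K, fun x hx => hK hx (subset_closure (mem_chamber_self hb))⟩

theorem exists_dist_orbit_le (hX : IsCAT0 X) (hW : IsCocompactDiscreteReflectionGroup W)
    (hb : b ∈ wallComplement W) : ∃ K, ∀ x, ∃ w ∈ W, dist x (w b) ≤ K := by
  obtain ⟨K, hK⟩ := hW.exists_dist_chamber_le hX hb
  refine ⟨1 + K, fun x => ?_⟩
  obtain ⟨y, hy, hxy⟩ := Metric.mem_closure_iff.1 (hW.dense_wallComplement x) 1 one_pos
  obtain ⟨g, hg, hgy⟩ := hW.exists_apply_mem_chamber hX hb hy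
  refine ⟨g⁻¹, W.inv_mem hg, ?_⟩
  have h1 := hK _ (subset_closure hgy)
  rw [← g⁻¹.dist_eq, IsometryEquiv.inv_apply_self] at h1
  linarith [dist_triangle x y (g⁻¹ b)]

/-- A closed ball is covered by finitely many translates of the compact closed chamber. Their union
is closed, so it is enough to approximate by points off the walls. -/
theorem properSpace (hX : IsCAT0 X) (hW : IsCocompactDiscreteReflectionGroup W)
    (hb : b ∈ wallComplement W) : ProperSpace X := by
  refine ⟨fun x N => ?_⟩
  obtain ⟨K, hK⟩ := hW.exists_dist_chamber_le hX hb
  have hfin := hW.finite_dist_le x b (N + 1 + K)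
  have hc : IsCompact (⋃ g ∈ {g : X ≃ᵢ X | g ∈ W ∧ dist x (g b) ≤ N + 1 + K},
      g '' closure (chamber W b)) :=
    hfin.isCompact_biUnion fun g _ => (hW.isCompact_closure_chamber hX hb).image g.continuous
  refine hc.of_isClosed_subset Metric.isClosed_closedBall fun p hp => ?_
  rw [← hc.isClosed.closure_eq, Metric.mem_closure_iff]
  intro ε hε
  obtain ⟨y, hy, hpy⟩ := Metric.mem_closure_iff.1 (hW.dense_wallComplement p) (min ε 1)
    (by positivity)
  rw [lt_min_iff] at hpy
  obtain ⟨g, hg, hgy⟩ := hW.exists_apply_mem_chamber hX hb hy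
  refine ⟨y, Set.mem_biUnion (x := g⁻¹) ⟨W.inv_mem hg, ?_⟩
    ⟨g y, subset_closure hgy, IsometryEquiv.inv_apply_self g y⟩, hpy.1⟩
  have h1 := hK _ (subset_closure hgy)
  rw [← g⁻¹.dist_eq, IsometryEquiv.inv_apply_self] at h1
  rw [Metric.mem_closedBall, dist_comm] at hp
  linarith [dist_triangle4 x p y (g⁻¹ b), hpy.2]

theorem isOfFinOrder_of_apply_eq (hW : IsCocompactDiscreteReflectionGroup W) (hw : w ∈ W)
    (hz : w z = z) : IsOfFinOrder w := by
  by_contra hcon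
  refine Set.infinite_range_of_injective (injective_pow_iff_not_isOfFinOrder.2 hcon)
    ((hW.finite_dist_le z z 0).subset ?_)
  rintro _ ⟨n, rfl⟩
  have h : ∀ n : ℕ, (w ^ n) z = z := fun n => by
    induction n with
    | zero => rfl
    | succ n ih => rw [pow_succ, IsometryEquiv.mul_apply, hz, ih]
  refine ⟨W.pow_mem hw n, ?_⟩
  change dist z ((w ^ n) z) ≤ 0
  rw [h, dist_self]

end IsCocompactDiscreteReflectionGroup

namespace IsMinimalReflectionSet

/-- The bound is uniform over S because each s fixes a point of the closed chamber, which is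
bounded. -/
theorem exists_dist_generator_le (hX : IsCAT0 X) (hW : IsCocompactDiscreteReflectionGroup W)
    (hb : b ∈ wallComplement W) (hS : IsMinimalReflectionSet W b S) :
    ∃ K, 0 ≤ K ∧ ∀ s ∈ S, dist b (s b) ≤ K := by
  obtain ⟨K, hK⟩ := hW.exists_dist_chamber_le hX hb
  have hK0 := dist_nonneg.trans (hK b (subset_closure (mem_chamber_self hb)))
  refine ⟨K + K, by positivity, fun s hs => ?_⟩
  obtain ⟨z, hzs, hz⟩ := hS.exists_mem_wall hX hb hs
  have h1 := hK z (hS.mem_closure_chamber hX hW hb hs hzs hz)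
  have h2 : dist z (s b) = dist z b := by
    conv_lhs => rw [← show s z = z from hzs, s.dist_eq]
  linarith [dist_triangle b z (s b), dist_comm z b]

theorem dist_prod_le {K : ℝ} (hK : ∀ s ∈ S, dist b (s b) ≤ K) :
    ∀ l : List (X ≃ᵢ X), (∀ x ∈ l, x ∈ S) → dist b (l.prod b) ≤ l.length * K := by
  intro l
  induction l with
  | nil => intro _; simp
  | cons x l ih =>
    intro hl
    have h1 := ih fun y hy => hl y (List.mem_cons_of_mem _ hy)
    have h2 := hK x (hl x List.mem_cons_self)
    rw [List.prod_cons, List.length_cons, IsometryEquiv.mul_apply]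
    push_cast
    have h3 : dist (x b) (x (l.prod b)) = dist b (l.prod b) := x.dist_eq _ _
    linarith [dist_triangle b (x b) (x (l.prod b))]

/-- The orbit map is Lipschitz, so quasi-density for the word metric becomes coarse density in X. -/
theorem dist_apply_le (hX : IsCAT0 X) (hW : IsCocompactDiscreteReflectionGroup W)
    (hb : b ∈ wallComplement W) (hS : IsMinimalReflectionSet W b S) {K : ℝ}
    (hK : ∀ s ∈ S, dist b (s b) ≤ K) (hu : u ∈ W) (hv : v ∈ W) :
    dist (u b) (v b) ≤ wordDist S u v * K := by
  obtain ⟨l, hl, hlw, hlen⟩ := hS.exists_list_length_eq hX hW hb (W.mul_mem (W.inv_mem hu) hv)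
  have := dist_prod_le hK l hl
  rw [hlw, hlen, ← u.dist_eq, IsometryEquiv.mul_apply, IsometryEquiv.apply_inv_self] at this
  exact this

/-- Opposite half-spaces of `s` and `t` are disjoint if `s t` has infinite order. -/
theorem mem_posSide_or (hX : IsCAT0 X) (hW : IsCocompactDiscreteReflectionGroup W)
    (hb : b ∈ wallComplement W) (hS : IsMinimalReflectionSet W b S) (hs : s ∈ S) (ht : t ∈ S)
    (hst : ¬ IsOfFinOrder (s * t)) (x : X) : x ∈ posSide b s ∨ x ∈ posSide b t := by
  have hne : s ≠ t := by
    rintro rfl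
    rw [(hS.isReflection hs).mul_self] at hst
    exact hst IsOfFinOrder.one
  have hdisj : ∀ z, z ∈ wall s → z ∉ wall t := fun z hzs hzt =>
    hst (hW.isOfFinOrder_of_apply_eq (z := z) (W.mul_mem (hS.mem hs) (hS.mem ht)) (by
      rw [IsometryEquiv.mul_apply, show t z = z from hzt, show s z = z from hzs]))
  -- The wall of s is convex, misses the wall of t and has a point in front of t, so all of it is in
  -- front of t.
  have hwall : ∀ s ∈ S, ∀ t ∈ S, s ≠ t → (∀ z, z ∈ wall s → z ∉ wall t) →
      ∃ z ∈ wall s, ∀ x ∈ wall s, x ∈ posSide b t := by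
    intro s hs t ht hst hdisj
    obtain ⟨z, hzs, hz⟩ := hS.exists_mem_wall hX hb hs
    refine ⟨z, hzs, fun x hx => ?_⟩
    rw [posSide_eq_of_mem (hz t ht hst.symm)]
    exact hX.geodesic.mem_connectedComponentIn fun y hy =>
      hdisj y (mem_wall_of_between hX hzs hx hy)
  obtain ⟨z₁, hz₁, hs'⟩ := hwall s hs t ht hne hdisj
  obtain ⟨-, -, ht'⟩ := hwall t ht s hs hne.symm fun z h1 h2 => hdisj z h2 h1
  by_contra! hx
  -- For x behind both walls, a path from z₁ on the wall of s meets the wall of t at q, then the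
  -- wall of s again at q' on the way to x. Convexity puts q on both walls.
  obtain ⟨q, hqt, hq⟩ := IsReflection.exists_between_mem_wall hX hx.2 (hs' z₁ hz₁)
  obtain ⟨q', hqs', hq'⟩ := IsReflection.exists_between_mem_wall hX hx.1 (ht' q hqt)
  refine hdisj q (mem_wall_of_between hX hz₁ hqs' ?_) hqt
  linarith [dist_triangle z₁ q q', dist_triangle z₁ q' x]

/-- A geodesic from the sector behind `s` to the sector behind `t` passes through the chamber. -/
theorem exists_between_mem_chamber (hX : IsCAT0 X) (hW : IsCocompactDiscreteReflectionGroup W)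
    (hb : b ∈ wallComplement W) (hS : IsMinimalReflectionSet W b S) (hs : s ∈ S) (ht : t ∈ S)
    (hst : ¬ IsOfFinOrder (s * t)) (hp : ∀ u ∈ S, u ≠ s → p ∈ posSide b u)
    (hz : ∀ u ∈ S, u ≠ t → z ∈ posSide b u) :
    ∃ c ∈ chamber W b, dist p c + dist c z = dist p z := by
  have hne : s ≠ t := by
    rintro rfl
    rw [(hS.isReflection hs).mul_self] at hst
    exact hst IsOfFinOrder.one
  -- p is in front of t, z is in front of s, and these two open sides cover X, so the connected
  -- geodesic has a point in both. All other walls are handled by convexity.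
  obtain ⟨c, hc, hct, hcs⟩ := hX.geodesic.exists_between_mem_inter (isOpen_posSide hX b t)
    (isOpen_posSide hX b s)
    (Set.eq_univ_of_forall fun x => (hS.mem_posSide_or hX hW hb hs ht hst x).symm)
    (hp t ht hne.symm) (hz s hs hne)
  refine ⟨c, hS.mem_chamber_iff.2 fun u hu => ?_, hc⟩
  by_cases hus : u = s
  · rwa [hus]
  by_cases hut : u = t
  · rwa [hut]
  exact (hS.isReflection hu).convex_posSide (hS.notMem_wall hb hu) p (hp u hu hus) z
    (hz u hu hut) c ((onGeodesic_iff hX.geodesic).2 hc)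

theorem inv_apply_mem_of_mem_lastLetterSet (hX : IsCAT0 X)
    (hW : IsCocompactDiscreteReflectionGroup W) (hb : b ∈ wallComplement W)
    (hS : IsMinimalReflectionSet W b S) (hw : w ∈ lastLetterSet W S s) (hu : u ∈ S) (hus : u ≠ s) :
    w⁻¹ b ∈ posSide b u :=
  hS.inv_apply_mem_posSide hX hW hb hw.1.1 hu (hw.1.2 u ⟨hu, hus⟩)

/-- The point is behind t, hence in front of s by the covering property. For the remaining u the
rank-two statement for the pair u, t applies. -/
theorem apply_inv_apply_mem_of_mem_lastLetterSet (hX : IsCAT0 X)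
    (hW : IsCocompactDiscreteReflectionGroup W) (hb : b ∈ wallComplement W)
    (hS : IsMinimalReflectionSet W b S) (hs : s ∈ S) (ht : t ∈ S)
    (hst : ¬ IsOfFinOrder (s * t)) (hw : w ∈ lastLetterSet W S s) (hu : u ∈ S) (hut : u ≠ t) :
    t (w⁻¹ b) ∈ posSide b u := by
  have hne : t ≠ s := by
    rintro rfl
    rw [(hS.isReflection hs).mul_self] at hst
    exact hst IsOfFinOrder.one
  have hmem := fun u hu hus => hS.inv_apply_mem_of_mem_lastLetterSet (u := u) hX hW hb hw hu hus
  by_cases hus : u = s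
  · rw [hus]
    exact (hS.mem_posSide_or hX hW hb hs ht hst _).resolve_right
      ((hS.isReflection ht).apply_notMem_posSide (hS.notMem_wall hb ht) (hmem t ht hne))
  · exact hS.mul_inv_apply_mem_posSide hX hW hb hw.1.1 hu ht hut (hmem u hu hus) (hmem t ht hne)

/-- If `W` is infinite, a quasi-dense subset has unbounded orbits. -/
theorem exists_lt_dist (hX : IsCAT0 X) (hW : IsCocompactDiscreteReflectionGroup W)
    (hb : b ∈ wallComplement W) (hS : IsMinimalReflectionSet W b S) {A : Set (X ≃ᵢ X)}
    (hAW : ∀ w ∈ A, w ∈ W) (hA : IsQuasiDense W S A) (hu : u ∈ W) (hu' : ¬ IsOfFinOrder u)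
    (M : ℝ) : ∃ w ∈ A, M < dist b (w b) := by
  by_contra! hcon
  obtain ⟨K, hK0, hK⟩ := hS.exists_dist_generator_le hX hW hb
  obtain ⟨N, -, hN⟩ := hA
  -- A bounded A-orbit would confine all powers of u to a bounded orbit, contradicting properness.
  refine Set.infinite_range_of_injective (injective_pow_iff_not_isOfFinOrder.2 hu')
    ((hW.finite_dist_le b b (M + N * K)).subset ?_)
  rintro _ ⟨n, rfl⟩
  have hun := W.pow_mem hu n
  refine ⟨hun, ?_⟩
  obtain ⟨a, ha, hle⟩ := hN _ hun
  have h1 := hS.dist_apply_le hX hW hb hK hun (hAW a ha)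
  have h2 : (wordDist S (u ^ n) a : ℝ) * K ≤ N * K :=
    mul_le_mul_of_nonneg_right (by exact_mod_cast hle) hK0
  change dist b ((u ^ n) b) ≤ _
  linarith [dist_triangle b (a b) ((u ^ n) b), dist_comm (a b) ((u ^ n) b), hcon a ha]

end IsMinimalReflectionSet

end CoarseGeometry

/-! ### Limit rays along an ultrafilter and density in the cone topology. -/

section Rays

open Filter Topology

variable {X : Type*} [MetricSpace X]

theorem GeodesicRay.dist_apply (c : GeodesicRay X) (s t : ℝ≥0) :
    dist (c.1 s) (c.1 t) = |(s : ℝ) - t| := by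
  rw [c.2.dist_eq, NNReal.dist_eq]

theorem GeodesicRay.dist_source (c : GeodesicRay X) (t : ℝ≥0) : dist (c.1 0) (c.1 t) = t := by
  rw [c.dist_apply, NNReal.coe_zero, zero_sub, abs_neg, NNReal.abs_eq]

theorem GeodesicRay.dist_add_dist (c : GeodesicRay X) {s t : ℝ≥0} (h : s ≤ t) :
    dist (c.1 0) (c.1 s) + dist (c.1 s) (c.1 t) = dist (c.1 0) (c.1 t) := by
  have h' : (s : ℝ) ≤ t := h
  rw [c.dist_source, c.dist_source, c.dist_apply, abs_sub_comm, abs_of_nonneg (by linarith)]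
  ring

theorem IsCAT0.dist_eq_abs_sub (hX : IsCAT0 X) {p z x y : X}
    (hx : dist p x + dist x z = dist p z) (hy : dist p y + dist y z = dist p z) :
    dist x y = |dist p x - dist p y| := by
  obtain ⟨ξ, hξ⟩ := hX.geodesic p z
  have key : ∀ x, dist p x + dist x z = dist p z →
      dist p x ∈ Set.Icc 0 (dist p z) ∧ ξ (dist p x) = x := fun x hx => by
    have hm : dist p x ∈ Set.Icc 0 (dist p z) :=
      ⟨dist_nonneg, by linarith [dist_nonneg (x := x) (y := z)]⟩
    refine ⟨hm, hX.eq_of_dist_eq ?_ hx (hξ.dist_left hm)⟩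
    rw [hξ.dist_left hm, hξ.dist_right hm]; ring
  conv_lhs => rw [← (key x hx).2, ← (key y hy).2]
  exact hξ.isometric _ (key x hx).1 _ (key y hy).1

theorem IsGeodesicSpace.exists_between (hX : IsGeodesicSpace X) (p z : X) {t : ℝ} (h0 : 0 ≤ t)
    (ht : t ≤ dist p z) : ∃ x, dist p x + dist x z = dist p z ∧ dist p x = t := by
  obtain ⟨ξ, hξ⟩ := hX p z
  have hm : t ∈ Set.Icc 0 (dist p z) := ⟨h0, ht⟩
  exact ⟨ξ t, by rw [hξ.dist_left hm, hξ.dist_right hm]; ring, hξ.dist_left hm⟩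

/-- The ray `c` is the limit along `U` of the geodesics from its source to the points `z n`. -/
def IsLimitRay (U : Ultrafilter ℕ) (z : ℕ → X) (c : GeodesicRay X) : Prop :=
  ∀ (t : ℝ≥0) (y : ℕ → X), (∀ᶠ n in (U : Filter ℕ), dist (c.1 0) (y n) + dist (y n) (z n) =
    dist (c.1 0) (z n) ∧ dist (c.1 0) (y n) = t) → Tendsto y U (𝓝 (c.1 t))

variable {U : Ultrafilter ℕ} {z : ℕ → X} {b : X}

theorem eventually_le_dist (hz : Tendsto (fun n => dist b (z n)) U atTop) (p : X) (t : ℝ) :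
    ∀ᶠ n in (U : Filter ℕ), t ≤ dist p (z n) := by
  filter_upwards [hz.eventually_ge_atTop (t + dist b p)] with n hn
  linarith [dist_triangle b p (z n)]

theorem exists_eventually_between (hX : IsGeodesicSpace X)
    (hz : Tendsto (fun n => dist b (z n)) U atTop) (p : X) (t : ℝ≥0) :
    ∃ y : ℕ → X, ∀ᶠ n in (U : Filter ℕ), dist p (y n) + dist (y n) (z n) = dist p (z n) ∧
      dist p (y n) = t := by
  have h : ∀ n, ∃ x, (t : ℝ) ≤ dist p (z n) →
      dist p x + dist x (z n) = dist p (z n) ∧ dist p x = t := fun n => by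
    by_cases ht : (t : ℝ) ≤ dist p (z n)
    · obtain ⟨x, hx⟩ := hX.exists_between p (z n) t.2 ht
      exact ⟨x, fun _ => hx⟩
    · exact ⟨p, fun h => absurd h ht⟩
  choose y hy using h
  exact ⟨y, (eventually_le_dist hz p t).mono hy⟩

theorem exists_isLimitRay [ProperSpace X] (hX : IsCAT0 X)
    (hz : Tendsto (fun n => dist b (z n)) U atTop) (p : X) :
    ∃ c : GeodesicRay X, c.1 0 = p ∧ IsLimitRay U z c := by
  choose y hy using fun t => exists_eventually_between hX.geodesic hz p t
  have hlim : ∀ t, ∃ x, Tendsto (y t) U (𝓝 x) := fun t => by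
    -- Using an ultrafilter instead of subsequences makes the limits at all times, and for all
    -- sources, simultaneous.
    obtain ⟨x, -, hx⟩ := (isCompact_closedBall p (t : ℝ)).ultrafilter_le_nhds (U.map (y t)) (by
      rw [le_principal_iff, Ultrafilter.coe_map, mem_map]
      filter_upwards [hy t] with n hn
      rw [Set.mem_preimage, Metric.mem_closedBall, dist_comm]
      exact hn.2.le)
    exact ⟨x, hx⟩
  choose f hf using hlim
  have hiso : Isometry f := Isometry.of_dist_eq fun s t => by
    refine tendsto_nhds_unique ((hf s).dist (hf t)) (tendsto_const_nhds.congr' ?_)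
    filter_upwards [hy s, hy t] with n hs ht
    rw [hX.dist_eq_abs_sub hs.1 ht.1, hs.2, ht.2, NNReal.dist_eq]
  have hf0 : f 0 = p := by
    refine tendsto_nhds_unique (hf 0) (tendsto_const_nhds.congr' ?_)
    filter_upwards [hy 0] with n hn
    exact dist_eq_zero.1 hn.2
  refine ⟨⟨⟨f, hiso.continuous⟩, hiso⟩, hf0, fun t y' hy' => (hf t).congr' ?_⟩
  change ∀ᶠ n in (U : Filter ℕ), dist (f 0) (y' n) + _ = dist (f 0) _ ∧ dist (f 0) _ = _ at hy'
  rw [hf0] at hy'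
  filter_upwards [hy t, hy'] with n h1 h2
  exact hX.eq_of_dist_eq h1.1 h2.1 (h1.2.trans h2.2.symm)

/-- Limit rays towards the same sequence are asymptotic. -/
theorem IsLimitRay.dist_le (hX : IsCAT0 X) (hz : Tendsto (fun n => dist b (z n)) U atTop)
    {c c' : GeodesicRay X} (hc : IsLimitRay U z c) (hc' : IsLimitRay U z c') (t : ℝ≥0) :
    dist (c.1 t) (c'.1 t) ≤ dist (c.1 0) (c'.1 0) := by
  obtain ⟨y, hy⟩ := exists_eventually_between hX.geodesic hz (c.1 0) t
  obtain ⟨y', hy'⟩ := exists_eventually_between hX.geodesic hz (c'.1 0) t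
  refine le_of_tendsto ((hc t y hy).dist (hc' t y' hy')) ?_
  filter_upwards [hy, hy'] with n h1 h2
  exact hX.dist_le_of_common_target h1.1 h2.1 (h1.2.trans h2.2.symm)

theorem IsLimitRay.endpoint_eq (hX : IsCAT0 X) (hz : Tendsto (fun n => dist b (z n)) U atTop)
    {c c' : GeodesicRay X} (hc : IsLimitRay U z c) (hc' : IsLimitRay U z c') :
    endpoint c = endpoint c' :=
  Quotient.sound (s := asymptotic X) ⟨_, hc.dist_le hX hz hc'⟩

/-- If the geodesics towards `z n` pass near `q` then so does the limit ray. -/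
theorem IsLimitRay.dist_apply_nndist_le (hX : IsCAT0 X)
    (hz : Tendsto (fun n => dist b (z n)) U atTop) {c : GeodesicRay X} (hc : IsLimitRay U z c)
    {q : X} {K : ℝ} (h : ∀ n, ∃ x, dist x q ≤ K ∧
      dist (c.1 0) x + dist x (z n) = dist (c.1 0) (z n)) :
    dist (c.1 (nndist (c.1 0) q)) q ≤ K + K := by
  obtain ⟨y, hy⟩ := exists_eventually_between hX.geodesic hz (c.1 0) (nndist (c.1 0) q)
  refine le_of_tendsto ((hc _ y hy).dist tendsto_const_nhds) ?_
  filter_upwards [hy] with n hn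
  obtain ⟨x, hxq, hx⟩ := h n
  -- y n and x lie on the same geodesic, at distances from the source differing by at most d(x, q).
  have h1 : dist (y n) x ≤ K := by
    rw [hX.dist_eq_abs_sub hn.1 hx, hn.2, coe_nndist, abs_le]
    constructor <;> linarith [dist_triangle (c.1 0) x q, dist_triangle (c.1 0) q x, dist_comm x q]
  linarith [dist_triangle (y n) x q]

/-- Every boundary point is represented by a ray from any given point. -/
theorem exists_ray_endpoint_eq [ProperSpace X] (hX : IsCAT0 X) (x₀ : X) (β : Boundary X) :
    ∃ c : GeodesicRay X, c.1 0 = x₀ ∧ endpoint c = β := by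
  induction β using Quotient.inductionOn with | _ c
  have hz : Tendsto (fun n : ℕ => dist (c.1 0) (c.1 n)) (hyperfilter ℕ : Ultrafilter ℕ) atTop := by
    have h : Tendsto (fun n : ℕ => dist (c.1 0) (c.1 n)) atTop atTop := by
      simp only [GeodesicRay.dist_source]
      exact tendsto_natCast_atTop_atTop
    exact h.mono_left Nat.hyperfilter_le_atTop
  obtain ⟨c', hc'0, hc'⟩ := exists_isLimitRay hX hz x₀
  -- The ray c is itself the limit ray from its source towards its own points c(n).
  refine ⟨c', hc'0, hc'.endpoint_eq hX hz fun t y hy => tendsto_const_nhds.congr' ?_⟩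
  have hn : ∀ᶠ n : ℕ in (hyperfilter ℕ : Ultrafilter ℕ), t ≤ (n : ℝ≥0) :=
    (tendsto_natCast_atTop_atTop.eventually_ge_atTop t).filter_mono Nat.hyperfilter_le_atTop
  filter_upwards [hy, hn] with n h1 h2
  exact hX.eq_of_dist_eq (c.dist_add_dist h2) h1.1 ((c.dist_source t).trans h1.2.symm)

/-- Rays with a common source that are K-close at time T are tK/T-close at each earlier time t; this
is what turns bounded distance into convergence. -/
theorem IsCAT0.ray_dist_le (hX : IsCAT0 X) {c c' : GeodesicRay X} (h : c.1 0 = c'.1 0)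
    {t T : ℝ≥0} (hT : 0 < T) (htT : t ≤ T) :
    dist (c.1 t) (c'.1 t) ≤ t / T * dist (c.1 T) (c'.1 T) := by
  have hT' : (0 : ℝ) < T := hT
  have htT' : (t : ℝ) ≤ T := htT
  have key : ∀ c : GeodesicRay X, dist (c.1 0) (c.1 t) = (t / T : ℝ) * dist (c.1 0) (c.1 T) ∧
      dist (c.1 t) (c.1 T) = (1 - t / T : ℝ) * dist (c.1 0) (c.1 T) := fun c => by
    rw [c.dist_source, c.dist_source, c.dist_apply, abs_sub_comm, abs_of_nonneg (by linarith)]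
    constructor <;> field_simp
  refine hX.dist_le_mul (p := c.1 0) (by positivity) ((div_le_one hT').2 htT') (key c).1 (key c).2
    ?_ ?_
  · rw [h]; exact (key c').1
  · rw [h]; exact (key c').2

/-- A set of boundary points is dense if rays to it pass at bounded distance from every point
of every ray. -/
theorem dense_coneTopology [ProperSpace X] (hX : IsCAT0 X) (x₀ : X) {A : Set (Boundary X)} {K : ℝ}
    (h : ∀ c : GeodesicRay X, c.1 0 = x₀ → ∀ n : ℕ, ∃ c' : GeodesicRay X, c'.1 0 = x₀ ∧
      endpoint c' ∈ A ∧ dist (c.1 n) (c'.1 n) ≤ K) :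
    @Dense (Boundary X) (coneTopology x₀) A := by
  let _ := coneTopology x₀
  rw [dense_iff_inter_open]
  rintro V hV ⟨β, hβ⟩
  obtain ⟨c, hc0, rfl⟩ := exists_ray_endpoint_eq hX x₀ β
  choose c' hc'0 hc'A hc' using h c hc0
  have hV' := isOpen_coinduced.1 hV
  let F : ℕ → {c : GeodesicRay X // c.1 0 = x₀} := fun n => ⟨c' n, hc'0 n⟩
  have hF : Tendsto F atTop (𝓝 ⟨c, hc0⟩) := by
    rw [tendsto_subtype_rng, tendsto_subtype_rng,
      ContinuousMap.tendsto_iff_forall_isCompact_tendstoUniformlyOn]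
    intro Q hQ
    obtain ⟨T, hT⟩ := hQ.bddAbove
    rw [Metric.tendstoUniformlyOn_iff]
    intro ε hε
    have hlim : Tendsto (fun n : ℕ => T * K / (n : ℝ)) atTop (𝓝 0) :=
      tendsto_const_div_atTop_nhds_zero_nat _
    filter_upwards [hlim.eventually_lt_const hε, eventually_gt_atTop 0,
      tendsto_natCast_atTop_atTop.eventually_ge_atTop T] with n hn hn0 hnT t ht
    have htT := hT ht
    have hn0' : (0 : ℝ≥0) < n := by exact_mod_cast hn0
    have h1 := hX.ray_dist_le (c := c) (c' := c' n) (hc0.trans (hc'0 n).symm) hn0' (htT.trans hnT)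
    have hK : 0 ≤ K := dist_nonneg.trans (hc' n)
    refine h1.trans_lt (lt_of_le_of_lt ?_ hn)
    rw [NNReal.coe_natCast, mul_comm (T : ℝ), mul_div_assoc, mul_comm]
    have htT' : (t : ℝ) ≤ T := htT
    gcongr
    exact hc' n
  obtain ⟨n, hn⟩ := (hF.eventually_mem (hV'.mem_nhds hβ)).exists
  exact ⟨endpoint (c' n), hn, hc'A n⟩

end Rays

end CATReflection

/-! ### The main theorem. -/

open CATReflection Filter in
theorem mainTheorem5 {X : Type*} [MetricSpace X] (hX : CATReflection.IsCAT0 X)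
    (W : Subgroup (X ≃ᵢ X)) (hW : CATReflection.IsCocompactDiscreteReflectionGroup W)
    (b : X) (hb : b ∈ CATReflection.wallComplement W)
    (S : Set (X ≃ᵢ X)) (hS : CATReflection.IsMinimalReflectionSet W b S)
    (s₀ : X ≃ᵢ X) (hs₀ : s₀ ∈ S) (t₀ : X ≃ᵢ X) (ht₀ : t₀ ∈ S)
    (hdense : CATReflection.IsQuasiDense W S (CATReflection.lastLetterSet W S s₀))
    (horder : ¬ IsOfFinOrder (s₀ * t₀)) :
    ∃ α : CATReflection.Boundary X, ∀ x₀ : X,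
      @Dense (CATReflection.Boundary X) (CATReflection.coneTopology x₀) (MulAction.orbit W α) := by
  have : ProperSpace X := hW.properSpace hX hb
  obtain ⟨D, hD⟩ := hW.exists_dist_chamber_le hX hb
  obtain ⟨E, hE⟩ := hW.exists_dist_orbit_le hX hb
  obtain ⟨K, hK0, hK⟩ := hS.exists_dist_generator_le hX hW hb
  -- The extra K absorbs the displacement d(b, t₀ b), so that d(b, z n) still exceeds n.
  choose w hw hwn using fun n : ℕ => hS.exists_lt_dist hX hW hb (fun _ h => h.1.1) hdense
    (W.mul_mem (hS.mem hs₀) (hS.mem ht₀)) horder (n + K)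
  let z : ℕ → X := fun n => t₀ ((w n)⁻¹ b)
  have hzS : ∀ n, ∀ u ∈ S, u ≠ t₀ → z n ∈ posSide b u := fun n u hu hut =>
    hS.apply_inv_apply_mem_of_mem_lastLetterSet hX hW hb hs₀ ht₀ horder (hw n) hu hut
  have hz : Tendsto (fun n => dist b (z n)) (hyperfilter ℕ : Ultrafilter ℕ) atTop := by
    refine (tendsto_atTop_mono (fun n => ?_) tendsto_natCast_atTop_atTop).mono_left
      Nat.hyperfilter_le_atTop
    have h1 : dist (t₀ b) (z n) = dist b (w n b) := by
      rw [t₀.dist_eq, ← (w n).dist_eq, IsometryEquiv.apply_inv_self, dist_comm]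
    linarith [hwn n, hK t₀ ht₀, dist_triangle (t₀ b) b (z n), dist_comm (t₀ b) b]
  choose ρ hρ0 hρ using fun p => exists_isLimitRay hX hz p
  refine ⟨endpoint (ρ b), fun x₀ => ?_⟩
  obtain ⟨N, -, hN⟩ := hdense
  -- The three summands bound the distance from c(n) to v b, from v b to the new ray at time τ, and
  -- along that ray from τ to n.
  refine dense_coneTopology hX x₀
    (K := (E + N * K) + (dist x₀ b + (D + D)) + (dist x₀ b + (E + N * K))) fun c hc0 n => ?_
  obtain ⟨g, hg, hgE⟩ := hE (c.1 n)
  obtain ⟨v, hv, hgv⟩ := hN g hg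
  -- The translate by v of the ray from v⁻¹x₀ to α: it starts at x₀ and ends at vα.
  refine ⟨mapRay v (ρ (v⁻¹ x₀)), ?_, ⟨⟨v, hv.1.1⟩, ?_⟩, ?_⟩
  · change v ((ρ (v⁻¹ x₀)).1 0) = x₀
    rw [hρ0, IsometryEquiv.apply_inv_self]
  · change endpoint (mapRay v (ρ b)) = _
    have h1 := (hρ b).endpoint_eq hX hz (hρ (v⁻¹ x₀))
    exact congrArg (v • ·) h1
  · have h1 : dist (c.1 n) (v b) ≤ E + N * K := by
      have h2 : (wordDist S g v : ℝ) * K ≤ N * K :=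
        mul_le_mul_of_nonneg_right (by exact_mod_cast hgv) hK0
      linarith [dist_triangle (c.1 n) (g b) (v b), hS.dist_apply_le hX hW hb hK hg hv.1.1]
    -- τ = d(b, v b) is the time at which the ray from v⁻¹b to α is near b; it differs from n =
    -- d(x₀, c(n)) by at most d(x₀, b) + d(c(n), v b).
    set τ : ℝ≥0 := nndist (v⁻¹ b) b with hτ
    have h2 : dist ((ρ (v⁻¹ b)).1 τ) b ≤ D + D := by
      have := (hρ (v⁻¹ b)).dist_apply_nndist_le hX hz (q := b) (K := D) fun n => by
        obtain ⟨x, hx, hxz⟩ := hS.exists_between_mem_chamber hX hW hb hs₀ ht₀ horder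
          (fun u hu hus => hS.inv_apply_mem_of_mem_lastLetterSet hX hW hb hv hu hus) (hzS n)
        exact ⟨x, hD x (subset_closure hx), by rw [hρ0]; exact hxz⟩
      rwa [hρ0] at this
    have h3 : dist ((ρ (v⁻¹ x₀)).1 τ) ((ρ (v⁻¹ b)).1 τ) ≤ dist x₀ b := by
      have := (hρ (v⁻¹ x₀)).dist_le hX hz (hρ (v⁻¹ b)) τ
      rwa [hρ0, hρ0, v⁻¹.dist_eq] at this
    have h4 : dist (v ((ρ (v⁻¹ x₀)).1 τ)) (v b) ≤ dist x₀ b + (D + D) := by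
      rw [v.dist_eq]
      linarith [dist_triangle ((ρ (v⁻¹ x₀)).1 τ) ((ρ (v⁻¹ b)).1 τ) b]
    have h5 : dist (v ((ρ (v⁻¹ x₀)).1 τ)) (v ((ρ (v⁻¹ x₀)).1 n)) ≤ dist x₀ b + (E + N * K) := by
      rw [v.dist_eq, GeodesicRay.dist_apply, hτ, coe_nndist, ← v.dist_eq,
        IsometryEquiv.apply_inv_self, ← c.dist_source, hc0, abs_le]
      constructor <;> linarith [dist_triangle b x₀ (c.1 n), dist_triangle x₀ b (v b),
        dist_triangle b (c.1 n) (v b), dist_triangle x₀ (v b) (c.1 n), dist_comm b x₀,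
        dist_comm (v b) (c.1 n), dist_triangle b x₀ (v b), dist_triangle x₀ (c.1 n) (v b)]
    change dist (c.1 n) (v ((ρ (v⁻¹ x₀)).1 n)) ≤ _
    linarith [dist_triangle4 (c.1 n) (v b) (v ((ρ (v⁻¹ x₀)).1 τ)) (v ((ρ (v⁻¹ x₀)).1 n)),
      dist_comm (v b) (v ((ρ (v⁻¹ x₀)).1 τ))]
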